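/- Let $P\subset\mathbb R^2$ be a finite set of points in general position: no three points of $P$ are collinear, and no two different line segments with endpoints in $P$ are parallel or orthogonal. A spanning geometric graph of $P$ is a simple graph with vertex set $P$ whose edges are straight line segments; its cost is the sum of the Euclidean lengths of its edges. It is uniform 2D-monotone if there are orthogonal axes $x',y'$, the same for all pairs of points, such that any two points of $P$ are connected in the graph by a path along which the $x'$-coordinates of the vertices are monotone (weakly increasing or weakly decreasing) and the $y'$-coordinates of the vertices are monotone. Then, on a real RAM (exact real arithmetic $+,-,\times,/,\sqrt{\ }$ and comparisons at unit cost, no rounding of reals to integers, and integer words of $O(\log |P|)$ bits): (i) a uniform 2D-monotone spanning graph of $P$ of minimum cost can be computed in $O(|P|^3)$ time; (ii) a uniform 2D-monotone spanning graph of $P$ with the least number of edges can be computed in $O(|P|^3)$ time. -/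

import Mathlib

/-! ## Uniform 2D-monotone spanning graphs -/

/-- The Euclidean plane. -/
abbrev Plane : Type := EuclideanSpace ℝ (Fin 2)

/-- A finite sequence of reals is monotone: (weakly) increasing or (weakly) decreasing. -/
def MonotoneSeq (l : List ℝ) : Prop :=
  l.Pairwise (fun a b => a ≤ b) ∨ l.Pairwise (fun a b => b ≤ a)

/-- The orthogonal axes of a rotated Cartesian system, given by unit direction vectors. The
coordinates of `p` in this system are `inner ℝ u p` and `inner ℝ v p`. -/
def OrthogonalAxes (u v : Plane) : Prop :=
  ‖u‖ = 1 ∧ ‖v‖ = 1 ∧ inner ℝ u v = 0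

/-- A sequence of points is monotone with respect to both axes `u` and `v`. -/
def XYMonotoneSeq (u v : Plane) (l : List Plane) : Prop :=
  MonotoneSeq (l.map fun p => inner ℝ u p) ∧ MonotoneSeq (l.map fun p => inner ℝ v p)

/-- A spanning geometric graph of the point set `{P 0, …, P (n-1)}` is a simple graph on the
indices, drawn with straight segments. It is `uv`-monotone if any two of the points are connected
by a path whose vertex sequence is `uv`-monotone. -/
def XYMonotoneGraph {n : ℕ} (P : Fin n → Plane) (u v : Plane) (G : SimpleGraph (Fin n)) : Prop :=
  ∀ i j : Fin n, ∃ w : G.Walk i j, w.IsPath ∧ XYMonotoneSeq u v (w.support.map P)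

/-- The graph is `uv`-monotone for some orthogonal axes `u, v`, the same for all pairs. -/
def UniformMonotone2D {n : ℕ} (P : Fin n → Plane) (G : SimpleGraph (Fin n)) : Prop :=
  ∃ u v : Plane, OrthogonalAxes u v ∧ XYMonotoneGraph P u v G

open Classical in
/-- The cost of a geometric graph: the sum of the Euclidean lengths of its edges, each edge being
counted once, at its pair of endpoints in increasing order of index. -/
noncomputable def graphCost {n : ℕ} (P : Fin n → Plane) (G : SimpleGraph (Fin n)) : ℝ :=
  ∑ i : Fin n, ∑ j : Fin n, if i < j ∧ G.Adj i j then dist (P i) (P j) else 0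

/-- `G` is a uniform 2D-monotone spanning graph of `P` of minimum cost. -/
def IsMinCostUniform {n : ℕ} (P : Fin n → Plane) (G : SimpleGraph (Fin n)) : Prop :=
  UniformMonotone2D P G ∧
    ∀ H : SimpleGraph (Fin n), UniformMonotone2D P H → graphCost P G ≤ graphCost P H

/-- `G` is a uniform 2D-monotone spanning graph of `P` with the least number of edges. -/
def IsMinEdgesUniform {n : ℕ} (P : Fin n → Plane) (G : SimpleGraph (Fin n)) : Prop :=
  UniformMonotone2D P G ∧
    ∀ H : SimpleGraph (Fin n), UniformMonotone2D P H → G.edgeSet.ncard ≤ H.edgeSet.ncard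

/-- The points are distinct, no three of them are collinear, and no two different segments between
them are parallel (vanishing cross product) or orthogonal (vanishing inner product). -/
structure GeneralPosition {n : ℕ} (P : Fin n → Plane) : Prop where
  injective : Function.Injective P
  not_collinear : ∀ i j k : Fin n, i ≠ j → j ≠ k → i ≠ k → ¬ Collinear ℝ {P i, P j, P k}
  not_parallel : ∀ i j k l : Fin n, i ≠ j → k ≠ l → s(i, j) ≠ s(k, l) →
    (P j - P i) 0 * (P l - P k) 1 - (P j - P i) 1 * (P l - P k) 0 ≠ 0
  not_orthogonal : ∀ i j k l : Fin n, i ≠ j → k ≠ l → s(i, j) ≠ s(k, l) →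
    inner ℝ (P j - P i) (P l - P k) ≠ 0

/-! ## The real RAM

A random access machine with two kinds of storage: words, which hold natural numbers not exceeding
a bound `W`, and cells, which hold exact real numbers. Each kind has scalar variables and arrays.
The variable and array names are literals of the program, hence finitely many in any program; array
indices are computed at run time. Each operation (access, arithmetic, square root, comparison,
store, branch) costs one step. Words convert to reals, but there is no rounding from reals to words:
reals influence words only through comparisons. Programs contain no real constants. -/

namespace RealRAM

/-- Contents of the memory: word variables, real variables, word arrays, real arrays. -/
structure State where
  nvar : ℕ → ℕ
  rvar : ℕ → ℝ
  narr : ℕ → ℕ → ℕ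
  rarr : ℕ → ℕ → ℝ

/-- Word expressions. -/
inductive NExpr where
  | const (c : ℕ)
  | var (x : ℕ)
  | get (a : ℕ) (i : NExpr)
  | add (e f : NExpr)
  | sub (e f : NExpr)
  | mul (e f : NExpr)
  | div (e f : NExpr)

/-- Real expressions. -/
inductive RExpr where
  | ofNat (e : NExpr)
  | var (x : ℕ)
  | get (a : ℕ) (i : NExpr)
  | add (e f : RExpr)
  | sub (e f : RExpr)
  | mul (e f : RExpr)
  | div (e f : RExpr)
  | sqrt (e : RExpr)

/-- Tests. -/
inductive BExpr where
  | nlt (e f : NExpr)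
  | neq (e f : NExpr)
  | rlt (e f : RExpr)
  | not (b : BExpr)
  | and (b c : BExpr)
  | or (b c : BExpr)

/-- Programs. -/
inductive Cmd where
  | skip
  | nset (x : ℕ) (e : NExpr)
  | rset (x : ℕ) (e : RExpr)
  | nput (a : ℕ) (i : NExpr) (e : NExpr)
  | rput (a : ℕ) (i : NExpr) (e : RExpr)
  | seq (c d : Cmd)
  | cond (b : BExpr) (c d : Cmd)
  | loop (b : BExpr) (c : Cmd)

/-- Value of a word expression; subtraction is truncated at `0`, and `div` is the integer
quotient (`0` for the divisor `0`). -/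
def NExpr.eval (s : State) : NExpr → ℕ
  | .const c => c
  | .var x => s.nvar x
  | .get a i => s.narr a (i.eval s)
  | .add e f => e.eval s + f.eval s
  | .sub e f => e.eval s - f.eval s
  | .mul e f => e.eval s * f.eval s
  | .div e f => e.eval s / f.eval s

/-- No intermediate value in the evaluation of a word expression exceeds the word bound `W`. -/
def NExpr.Fits (W : ℕ) (s : State) : NExpr → Prop
  | .const c => c ≤ W
  | .var x => s.nvar x ≤ W
  | .get a i => i.Fits W s ∧ s.narr a (i.eval s) ≤ W
  | .add e f => e.Fits W s ∧ f.Fits W s ∧ e.eval s + f.eval s ≤ W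
  | .sub e f => e.Fits W s ∧ f.Fits W s
  | .mul e f => e.Fits W s ∧ f.Fits W s ∧ e.eval s * f.eval s ≤ W
  | .div e f => e.Fits W s ∧ f.Fits W s

/-- Number of operations in the evaluation of a word expression. -/
def NExpr.cost : NExpr → ℕ
  | .const _ => 1
  | .var _ => 1
  | .get _ i => i.cost + 1
  | .add e f => e.cost + f.cost + 1
  | .sub e f => e.cost + f.cost + 1
  | .mul e f => e.cost + f.cost + 1
  | .div e f => e.cost + f.cost + 1

/-- Value of a real expression. A quotient by `0` and the root of a negative number are `0`, which
a program could also arrange by a test. -/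
noncomputable def RExpr.eval (s : State) : RExpr → ℝ
  | .ofNat e => (e.eval s : ℝ)
  | .var x => s.rvar x
  | .get a i => s.rarr a (i.eval s)
  | .add e f => e.eval s + f.eval s
  | .sub e f => e.eval s - f.eval s
  | .mul e f => e.eval s * f.eval s
  | .div e f => e.eval s / f.eval s
  | .sqrt e => Real.sqrt (e.eval s)

/-- The word expressions inside a real expression respect the word bound. -/
def RExpr.Fits (W : ℕ) (s : State) : RExpr → Prop
  | .ofNat e => e.Fits W s
  | .var _ => True
  | .get _ i => i.Fits W s
  | .add e f => e.Fits W s ∧ f.Fits W s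
  | .sub e f => e.Fits W s ∧ f.Fits W s
  | .mul e f => e.Fits W s ∧ f.Fits W s
  | .div e f => e.Fits W s ∧ f.Fits W s
  | .sqrt e => e.Fits W s

/-- Number of operations in the evaluation of a real expression. -/
def RExpr.cost : RExpr → ℕ
  | .ofNat e => e.cost + 1
  | .var _ => 1
  | .get _ i => i.cost + 1
  | .add e f => e.cost + f.cost + 1
  | .sub e f => e.cost + f.cost + 1
  | .mul e f => e.cost + f.cost + 1
  | .div e f => e.cost + f.cost + 1
  | .sqrt e => e.cost + 1

/-- The test succeeds. -/
def BExpr.Holds (s : State) : BExpr → Prop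
  | .nlt e f => e.eval s < f.eval s
  | .neq e f => e.eval s = f.eval s
  | .rlt e f => e.eval s < f.eval s
  | .not b => ¬ b.Holds s
  | .and b c => b.Holds s ∧ c.Holds s
  | .or b c => b.Holds s ∨ c.Holds s

/-- The word expressions inside a test respect the word bound. -/
def BExpr.Fits (W : ℕ) (s : State) : BExpr → Prop
  | .nlt e f => e.Fits W s ∧ f.Fits W s
  | .neq e f => e.Fits W s ∧ f.Fits W s
  | .rlt e f => e.Fits W s ∧ f.Fits W s
  | .not b => b.Fits W s
  | .and b c => b.Fits W s ∧ c.Fits W s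
  | .or b c => b.Fits W s ∧ c.Fits W s

/-- Number of operations in the evaluation of a test. -/
def BExpr.cost : BExpr → ℕ
  | .nlt e f => e.cost + f.cost + 1
  | .neq e f => e.cost + f.cost + 1
  | .rlt e f => e.cost + f.cost + 1
  | .not b => b.cost + 1
  | .and b c => b.cost + c.cost + 1
  | .or b c => b.cost + c.cost + 1

/-- `Exec W c s t s'`: with word bound `W`, the program `c` started in the memory `s` halts after
exactly `t` steps in the memory `s'`. A computation that exceeds the word bound has no result. -/
inductive Exec (W : ℕ) : Cmd → State → ℕ → State → Prop where
  | skip (s : State) : Exec W .skip s 1 s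
  | nset (s : State) (x : ℕ) (e : NExpr) (he : e.Fits W s) :
      Exec W (.nset x e) s (e.cost + 1)
        { s with nvar := Function.update s.nvar x (e.eval s) }
  | rset (s : State) (x : ℕ) (e : RExpr) (he : e.Fits W s) :
      Exec W (.rset x e) s (e.cost + 1)
        { s with rvar := Function.update s.rvar x (e.eval s) }
  | nput (s : State) (a : ℕ) (i e : NExpr) (hi : i.Fits W s) (he : e.Fits W s) :
      Exec W (.nput a i e) s (i.cost + e.cost + 1)
        { s with narr :=
            Function.update s.narr a (Function.update (s.narr a) (i.eval s) (e.eval s)) }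
  | rput (s : State) (a : ℕ) (i : NExpr) (e : RExpr) (hi : i.Fits W s) (he : e.Fits W s) :
      Exec W (.rput a i e) s (i.cost + e.cost + 1)
        { s with rarr :=
            Function.update s.rarr a (Function.update (s.rarr a) (i.eval s) (e.eval s)) }
  | seq (c d : Cmd) (s₁ s₂ s₃ : State) (t₁ t₂ : ℕ)
      (hc : Exec W c s₁ t₁ s₂) (hd : Exec W d s₂ t₂ s₃) :
      Exec W (.seq c d) s₁ (t₁ + t₂) s₃
  | cond_true (b : BExpr) (c d : Cmd) (s s' : State) (t : ℕ) (hf : b.Fits W s)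
      (hb : b.Holds s) (hc : Exec W c s t s') :
      Exec W (.cond b c d) s (b.cost + 1 + t) s'
  | cond_false (b : BExpr) (c d : Cmd) (s s' : State) (t : ℕ) (hf : b.Fits W s)
      (hb : ¬ b.Holds s) (hd : Exec W d s t s') :
      Exec W (.cond b c d) s (b.cost + 1 + t) s'
  | loop_done (b : BExpr) (c : Cmd) (s : State) (hf : b.Fits W s) (hb : ¬ b.Holds s) :
      Exec W (.loop b c) s (b.cost + 1) s
  | loop_step (b : BExpr) (c : Cmd) (s₁ s₂ s₃ : State) (t₁ t₂ : ℕ) (hf : b.Fits W s₁)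
      (hb : b.Holds s₁) (hc : Exec W c s₁ t₁ s₂) (hl : Exec W (.loop b c) s₂ t₂ s₃) :
      Exec W (.loop b c) s₁ (b.cost + 1 + t₁ + t₂) s₃

/-- The initial memory: word variable `0` holds the number of points, the real arrays `0` and `1`
hold their first and second coordinates, and everything else is `0`. -/
noncomputable def inputState {n : ℕ} (P : Fin n → Plane) : State where
  nvar := fun x => if x = 0 then n else 0
  rvar := fun _ => 0
  narr := fun _ _ => 0
  rarr := fun a i =>
    if h : i < n then (if a = 0 then P ⟨i, h⟩ 0 else if a = 1 then P ⟨i, h⟩ 1 else 0) else 0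

open Classical in
/-- The word array `0` holds the adjacency matrix of `G`, row by row. -/
def Outputs {n : ℕ} (s : State) (G : SimpleGraph (Fin n)) : Prop :=
  ∀ i j : Fin n, s.narr 0 (i.val * n + j.val) = if G.Adj i j then 1 else 0

/-- For the graph problem on point sets that asks for any graph `G` with `Sol P G`, there is one
program which, on every point set in general position, given in any order, halts within `O(T |P|)`
steps, with words of `O(log |P|)` bits, and outputs a solution. -/
def SolvableInTime (T : ℕ → ℕ)
    (Sol : ∀ {n : ℕ}, (Fin n → Plane) → SimpleGraph (Fin n) → Prop) : Prop :=
  ∃ (prog : Cmd) (C k : ℕ), ∀ (n : ℕ) (P : Fin n → Plane), GeneralPosition P →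
    ∃ (t : ℕ) (s : State) (G : SimpleGraph (Fin n)),
      Exec (C * (n + 1) ^ k) prog (inputState P) t s ∧ t ≤ C * (T n + 1) ∧
        Outputs s G ∧ Sol P G

end RealRAM

/-! For fixed axes there is a least monotone graph: join two points when the closed axis-parallel
rectangle they span contains no third point. The first step of a monotone path from `i` to `j` stays
in their rectangle, so an empty rectangle forces the edge (`XYMonotoneGraph.emptyRectGraph_le`).
Conversely, splitting a nonempty rectangle at an inner point gives monotone paths by induction
(`emptyRectGraph_exists_walk`). Both problems thus ask for the axes whose empty-rectangle graph has
the least total weight, with the distance or the constant 1 as weight.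

Up to scaling, reflection and exchange, axes are `(1, κ)` and `(-κ, 1)` with `κ ≥ 0`
(`OrthogonalAxes.exists_slope`). That `m` blocks the pair `i, j` is a closed condition on `κ`, and
it can change only at a slope where `m` and one of the corners are aligned with an axis, the key of
that pair. Lowering `κ` to the nearest key, or to 0, therefore loses no blocked triple, so the graph
can only shrink, and 0 and the keys are the only candidates (`exists_critical_slope`). Minimizing
graph weight is maximizing the weight of blocked pairs (`graphWeight_add_blockedWeight`).

The program visits the keys in increasing order. General position makes the keys of different pairs
distinct, since equal keys mean parallel or orthogonal segments (`sweepFacts`). From one key to the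
next, only triples in which one of two pairs consists of a corner and the inner point can change.
These are linearly many, and each is repaired in constant time with a table of blocked triples, a
count per pair and a running weight (`sweepStep_runs`). The next key is also found in linear time:
every row keeps its least pending key, and only the row just used is rescanned. At most `n * n`
rounds of linear cost, plus cubic work before and after, give the bound. -/

namespace RealRAM

/-! ### Total correctness with time and word bounds -/

/-- Syntactic over-approximation: the command may write the word variable `x`. -/
def Cmd.writesN : Cmd → ℕ → Bool
  | .nset y _, x => y == x
  | .seq c d, x => c.writesN x || d.writesN x
  | .cond _ c d, x => c.writesN x || d.writesN x
  | .loop _ c, x => c.writesN x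
  | _, _ => false

/-- The command may write the real variable `x`. -/
def Cmd.writesR : Cmd → ℕ → Bool
  | .rset y _, x => y == x
  | .seq c d, x => c.writesR x || d.writesR x
  | .cond _ c d, x => c.writesR x || d.writesR x
  | .loop _ c, x => c.writesR x
  | _, _ => false

/-- The command may write the word array `a`. -/
def Cmd.writesNA : Cmd → ℕ → Bool
  | .nput b _ _, a => b == a
  | .seq c d, a => c.writesNA a || d.writesNA a
  | .cond _ c d, a => c.writesNA a || d.writesNA a
  | .loop _ c, a => c.writesNA a
  | _, _ => false

/-- The command may write the real array `a`. -/
def Cmd.writesRA : Cmd → ℕ → Bool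
  | .rput b _ _, a => b == a
  | .seq c d, a => c.writesRA a || d.writesRA a
  | .cond _ c d, a => c.writesRA a || d.writesRA a
  | .loop _ c, a => c.writesRA a
  | _, _ => false

/-- `s'` agrees with `s` on everything that `c` does not write. -/
structure Frame (c : Cmd) (s s' : State) : Prop where
  nvar : ∀ x, c.writesN x = false → s'.nvar x = s.nvar x
  rvar : ∀ x, c.writesR x = false → s'.rvar x = s.rvar x
  narr : ∀ x, c.writesNA x = false → s'.narr x = s.narr x
  rarr : ∀ x, c.writesRA x = false → s'.rarr x = s.rarr x

theorem Frame.refl (c : Cmd) (s : State) : Frame c s s :=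
  ⟨fun _ _ => rfl, fun _ _ => rfl, fun _ _ => rfl, fun _ _ => rfl⟩

theorem Frame.trans {c : Cmd} {s s' s'' : State} (h : Frame c s s') (h' : Frame c s' s'') :
    Frame c s s'' :=
  ⟨fun x hx => (h'.nvar x hx).trans (h.nvar x hx), fun x hx => (h'.rvar x hx).trans (h.rvar x hx),
    fun x hx => (h'.narr x hx).trans (h.narr x hx), fun x hx => (h'.rarr x hx).trans (h.rarr x hx)⟩

/-- Every write of `c` is a write of `d`. -/
def Cmd.WritesSub (c d : Cmd) : Prop :=
  (∀ x, d.writesN x = false → c.writesN x = false) ∧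
  (∀ x, d.writesR x = false → c.writesR x = false) ∧
  (∀ x, d.writesNA x = false → c.writesNA x = false) ∧
  (∀ x, d.writesRA x = false → c.writesRA x = false)

theorem Frame.mono {c d : Cmd} (hcd : c.WritesSub d) {s s' : State} (h : Frame c s s') :
    Frame d s s' :=
  ⟨fun x hx => h.nvar x (hcd.1 x hx), fun x hx => h.rvar x (hcd.2.1 x hx),
    fun x hx => h.narr x (hcd.2.2.1 x hx), fun x hx => h.rarr x (hcd.2.2.2 x hx)⟩

theorem Cmd.WritesSub.seq_left (c d : Cmd) : c.WritesSub (.seq c d) := by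
  simp +contextual [Cmd.WritesSub, Cmd.writesN, Cmd.writesR, Cmd.writesNA, Cmd.writesRA]

theorem Cmd.WritesSub.seq_right (c d : Cmd) : d.WritesSub (.seq c d) := by
  simp +contextual [Cmd.WritesSub, Cmd.writesN, Cmd.writesR, Cmd.writesNA, Cmd.writesRA]

theorem Cmd.WritesSub.cond_left (b : BExpr) (c d : Cmd) : c.WritesSub (.cond b c d) := by
  simp +contextual [Cmd.WritesSub, Cmd.writesN, Cmd.writesR, Cmd.writesNA, Cmd.writesRA]

theorem Cmd.WritesSub.cond_right (b : BExpr) (c d : Cmd) : d.WritesSub (.cond b c d) := by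
  simp +contextual [Cmd.WritesSub, Cmd.writesN, Cmd.writesR, Cmd.writesNA, Cmd.writesRA]

theorem Cmd.WritesSub.loop (b : BExpr) (c : Cmd) : c.WritesSub (.loop b c) := by
  simp [Cmd.WritesSub, Cmd.writesN, Cmd.writesR, Cmd.writesNA, Cmd.writesRA]

/-- The write sets are computed by recursion on the program text, so for concrete programs most side
conditions close by `rfl`. This keeps unchanged variables out of the loop invariants. -/
theorem Exec.frame {W : ℕ} {c : Cmd} {s s' : State} {t : ℕ} (h : Exec W c s t s') :
    Frame c s s' := by
  induction h with
  | skip s => exact Frame.refl _ _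
  | nset s x e he =>
    refine ⟨fun y hy => ?_, fun _ _ => rfl, fun _ _ => rfl, fun _ _ => rfl⟩
    have : y ≠ x := by rintro rfl; simp [Cmd.writesN] at hy
    simp [this]
  | rset s x e he =>
    refine ⟨fun _ _ => rfl, fun y hy => ?_, fun _ _ => rfl, fun _ _ => rfl⟩
    have : y ≠ x := by rintro rfl; simp [Cmd.writesR] at hy
    simp [this]
  | nput s a i e hi he =>
    refine ⟨fun _ _ => rfl, fun _ _ => rfl, fun y hy => ?_, fun _ _ => rfl⟩
    have : y ≠ a := by rintro rfl; simp [Cmd.writesNA] at hy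
    simp [this]
  | rput s a i e hi he =>
    refine ⟨fun _ _ => rfl, fun _ _ => rfl, fun _ _ => rfl, fun y hy => ?_⟩
    have : y ≠ a := by rintro rfl; simp [Cmd.writesRA] at hy
    simp [this]
  | seq c d s₁ s₂ s₃ t₁ t₂ hc hd ih₁ ih₂ =>
    exact (ih₁.mono (.seq_left c d)).trans (ih₂.mono (.seq_right c d))
  | cond_true b c d s s' t hf hb hc ih => exact ih.mono (.cond_left b c d)
  | cond_false b c d s s' t hf hb hd ih => exact ih.mono (.cond_right b c d)
  | loop_done b c s hf hb => exact Frame.refl _ _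
  | loop_step b c s₁ s₂ s₃ t₁ t₂ hf hb hc hl ih₁ ih₂ => exact (ih₁.mono (.loop b c)).trans ih₂

/-- Started in `s`, the command halts within `T` steps in a memory satisfying `Q`. -/
def Runs (W : ℕ) (c : Cmd) (s : State) (T : ℕ) (Q : State → Prop) : Prop :=
  ∃ t s', Exec W c s t s' ∧ t ≤ T ∧ Q s'

/-- Time bound of a command in which every loop runs at most `n` times. -/
def Cmd.time (n : ℕ) : Cmd → ℕ
  | .skip => 1
  | .nset _ e => e.cost + 1
  | .rset _ e => e.cost + 1
  | .nput _ i e => i.cost + e.cost + 1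
  | .rput _ i e => i.cost + e.cost + 1
  | .seq c d => c.time n + d.time n
  | .cond b c d => b.cost + 1 + max (c.time n) (d.time n)
  | .loop b c => n * (b.cost + 1 + c.time n) + (b.cost + 1)

/-- Nesting depth of loops. -/
def Cmd.depth : Cmd → ℕ
  | .seq c d => max c.depth d.depth
  | .cond _ c d => max c.depth d.depth
  | .loop _ c => c.depth + 1
  | _ => 0

/-- Leading constant of the time bound. -/
def Cmd.factor : Cmd → ℕ
  | .skip => 1
  | .nset _ e => e.cost + 1
  | .rset _ e => e.cost + 1
  | .nput _ i e => i.cost + e.cost + 1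
  | .rput _ i e => i.cost + e.cost + 1
  | .seq c d => c.factor + d.factor
  | .cond b c d => b.cost + 1 + (c.factor + d.factor)
  | .loop b c => b.cost + 1 + c.factor

/-- Each nested loop contributes one factor `n + 1`. For `cond` the constant is a sum rather than a
maximum, which dominates both branches. -/
theorem Cmd.time_le (n : ℕ) (c : Cmd) : c.time n ≤ c.factor * (n + 1) ^ c.depth := by
  have one (d : ℕ) : 1 ≤ (n + 1) ^ d := Nat.one_le_pow _ _ (Nat.succ_pos n)
  have mono {d e : ℕ} (h : d ≤ e) : (n + 1) ^ d ≤ (n + 1) ^ e :=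
    Nat.pow_le_pow_right (Nat.succ_pos n) h
  induction c with
  | seq c d hc hd =>
    simp only [Cmd.time, Cmd.factor, Cmd.depth, add_mul]
    exact add_le_add (hc.trans (Nat.mul_le_mul_left _ (mono (le_max_left _ _))))
      (hd.trans (Nat.mul_le_mul_left _ (mono (le_max_right _ _))))
  | cond b c d hc hd =>
    simp only [Cmd.time, Cmd.factor, Cmd.depth]
    rw [add_mul]
    refine add_le_add (Nat.le_mul_of_pos_right _ (one _)) (max_le ?_ ?_)
    · exact hc.trans (Nat.mul_le_mul (Nat.le_add_right _ _) (mono (le_max_left _ _)))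
    · exact hd.trans (Nat.mul_le_mul (Nat.le_add_left _ _) (mono (le_max_right _ _)))
  | loop b c hc =>
    simp only [Cmd.time, Cmd.factor, Cmd.depth]
    have h1 := one c.depth
    calc n * (b.cost + 1 + c.time n) + (b.cost + 1)
        = (b.cost + 1) * (n + 1) * 1 + n * c.time n := by ring
      _ ≤ (b.cost + 1) * (n + 1) * (n + 1) ^ c.depth
          + (n + 1) * (c.factor * (n + 1) ^ c.depth) :=
        add_le_add (Nat.mul_le_mul_left _ h1) (Nat.mul_le_mul (Nat.le_succ n) hc)
      _ = (b.cost + 1 + c.factor) * (n + 1) ^ (c.depth + 1) := by ring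
  | _ => simp [Cmd.time, Cmd.factor, Cmd.depth]

/-! ### Hoare-style rules with running times -/

section Rules
variable {W : ℕ} {n : ℕ} {s : State} {Q : State → Prop}

theorem Runs.mono {c : Cmd} {T T' : ℕ} {Q' : State → Prop} (h : Runs W c s T Q) (hT : T ≤ T')
    (hQ : ∀ s', Frame c s s' → Q s' → Q' s') : Runs W c s T' Q' := by
  obtain ⟨t, s', he, ht, hq⟩ := h
  exact ⟨t, s', he, ht.trans hT, hQ s' he.frame hq⟩

theorem Runs.imp {c : Cmd} {T : ℕ} {Q' : State → Prop} (h : Runs W c s T Q)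
    (hQ : ∀ s', Frame c s s' → Q s' → Q' s') : Runs W c s T Q' := h.mono le_rfl hQ

theorem Runs.skip (h : Q s) : Runs W .skip s (Cmd.time n .skip) Q :=
  ⟨_, _, .skip s, le_rfl, h⟩

theorem Runs.nset {x : ℕ} {e : NExpr} (he : e.Fits W s)
    (h : Q { s with nvar := Function.update s.nvar x (e.eval s) }) :
    Runs W (.nset x e) s (Cmd.time n (.nset x e)) Q := ⟨_, _, .nset s x e he, le_rfl, h⟩

theorem Runs.rset {x : ℕ} {e : RExpr} (he : e.Fits W s)
    (h : Q { s with rvar := Function.update s.rvar x (e.eval s) }) :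
    Runs W (.rset x e) s (Cmd.time n (.rset x e)) Q := ⟨_, _, .rset s x e he, le_rfl, h⟩

theorem Runs.nput {a : ℕ} {i e : NExpr} (hi : i.Fits W s) (he : e.Fits W s)
    (h : Q { s with narr :=
      Function.update s.narr a (Function.update (s.narr a) (i.eval s) (e.eval s)) }) :
    Runs W (.nput a i e) s (Cmd.time n (.nput a i e)) Q := ⟨_, _, .nput s a i e hi he, le_rfl, h⟩

theorem Runs.seq' {c d : Cmd} {T₁ T₂ : ℕ} {R : State → Prop} (hc : Runs W c s T₁ R)
    (hd : ∀ s', Frame c s s' → R s' → Runs W d s' T₂ Q) : Runs W (.seq c d) s (T₁ + T₂) Q := by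
  obtain ⟨t, s', he, ht, hr⟩ := hc
  obtain ⟨t', s'', he', ht', hq⟩ := hd s' he.frame hr
  exact ⟨_, _, .seq c d s s' s'' t t' he he', add_le_add ht ht', hq⟩

theorem Runs.seq {c d : Cmd} {R : State → Prop} (hc : Runs W c s (c.time n) R)
    (hd : ∀ s', Frame c s s' → R s' → Runs W d s' (d.time n) Q) :
    Runs W (.seq c d) s (Cmd.time n (.seq c d)) Q := hc.seq' hd

theorem Runs.cond {b : BExpr} {c d : Cmd} (hf : b.Fits W s)
    (hc : b.Holds s → Runs W c s (c.time n) Q) (hd : ¬ b.Holds s → Runs W d s (d.time n) Q) :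
    Runs W (.cond b c d) s (Cmd.time n (.cond b c d)) Q := by
  by_cases hb : b.Holds s
  · obtain ⟨t, s', he, ht, hq⟩ := hc hb
    exact ⟨_, _, .cond_true b c d s s' t hf hb he,
      Nat.add_le_add_left (ht.trans (le_max_left _ _)) _, hq⟩
  · obtain ⟨t, s', he, ht, hq⟩ := hd hb
    exact ⟨_, _, .cond_false b c d s s' t hf hb he,
      Nat.add_le_add_left (ht.trans (le_max_right _ _)) _, hq⟩

/-- A loop with an invariant `I` indexed by a bound on the number of remaining rounds. -/
theorem Runs.loop {b : BExpr} {c : Cmd} {T : ℕ} (I : ℕ → State → Prop) (s₀ : State)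
    (hf : ∀ k s, I k s → b.Fits W s)
    (hdone : ∀ k s, I k s → ¬ b.Holds s → Q s)
    (hstep : ∀ k s, I k s → b.Holds s → Frame (.loop b c) s₀ s →
      ∃ l, k = l + 1 ∧ Runs W c s T (I l)) :
    ∀ k s, Frame (.loop b c) s₀ s → I k s →
      Runs W (.loop b c) s (k * (b.cost + 1 + T) + (b.cost + 1)) Q := by
  intro k
  induction k with
  | zero =>
    intro s hfr hI
    by_cases hb : b.Holds s
    · obtain ⟨l, hl, -⟩ := hstep 0 s hI hb hfr
      omega
    · exact ⟨_, _, .loop_done b c s (hf 0 s hI) hb, by simp, hdone 0 s hI hb⟩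
  | succ k ih =>
    intro s hfr hI
    by_cases hb : b.Holds s
    · obtain ⟨l, hl, t, s', he, ht, hI'⟩ := hstep _ s hI hb hfr
      obtain rfl : k = l := by omega
      obtain ⟨t', s'', he', ht', hq⟩ := ih s' (hfr.trans (he.frame.mono (.loop b c))) hI'
      refine ⟨_, _, .loop_step b c s s' s'' t t' (hf _ s hI) hb he he', ?_, hq⟩
      calc b.cost + 1 + t + t' ≤ b.cost + 1 + T + (k * (b.cost + 1 + T) + (b.cost + 1)) := by
            omega
        _ = _ := by ring
    · exact ⟨_, _, .loop_done b c s (hf _ s hI) hb, by omega, hdone _ s hI hb⟩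

/-- `for x := 0, …, n - 1 do c`, where `n` is the word variable `0`. -/
def Cmd.forN (x : ℕ) (c : Cmd) : Cmd :=
  .seq (.nset x (.const 0))
    (.loop (.nlt (.var x) (.var 0)) (.seq c (.nset x (.add (.var x) (.const 1)))))

/-- `I k` holds when `k` rounds are finished. It must ignore the counter (`hstab`), which the loop
itself changes. The bound `n + 1 ≤ W` covers the counter, at most `n`, and the constant 1, also when
`n = 0`. -/
theorem Runs.forN {x : ℕ} {c : Cmd} (I : ℕ → State → Prop)
    (hx : (x == 0) = false) (hcx : c.writesN x = false) (hc0 : c.writesN 0 = false)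
    (hn : s.nvar 0 = n) (hW : n + 1 ≤ W)
    (hstab : ∀ k s v, I k s → I k { s with nvar := Function.update s.nvar x v })
    (hI : I 0 s)
    (hbody : ∀ k s', k < n → s'.nvar x = k → Frame (.forN x c) s s' → I k s' →
      Runs W c s' (c.time n) (I (k + 1))) :
    Runs W (.forN x c) s (Cmd.time n (.forN x c)) (I n) := by
  have hx0 : (0 : ℕ) ≠ x := by rintro rfl; simp at hx
  refine Runs.seq (R := fun s' => s'.nvar 0 = n ∧ s'.nvar x = 0 ∧ I 0 s') ?_ ?_
  · refine Runs.nset (by simp [NExpr.Fits]) ⟨?_, ?_, hstab 0 s _ hI⟩ <;>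
      simp [NExpr.eval, hx0, hn]
  rintro s₁ hfr ⟨h0, hx1, hI1⟩
  have key := Runs.loop (W := W) (Q := I n) (b := .nlt (.var x) (.var 0))
    (c := .seq c (.nset x (.add (.var x) (.const 1))))
    (T := Cmd.time n (.seq c (.nset x (.add (.var x) (.const 1)))))
    (fun r s' => s'.nvar 0 = n ∧ ∃ k, k + r = n ∧ s'.nvar x = k ∧ I k s') s
    (by
      rintro r s' ⟨h, k, hk, hxk, -⟩
      simp only [BExpr.Fits, NExpr.Fits]
      omega)
    (by
      rintro r s' ⟨h, k, hk, hxk, hIk⟩ hb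
      simp only [BExpr.Holds, NExpr.eval] at hb
      obtain rfl : k = n := by omega
      exact hIk)
    (by
      rintro r s' ⟨h, k, hk, hxk, hIk⟩ hb hfr'
      simp only [BExpr.Holds, NExpr.eval] at hb
      refine ⟨r - 1, by omega, ?_⟩
      refine Runs.seq (hbody k s' (by omega) hxk (hfr'.mono (.seq_right _ _)) hIk) ?_
      intro s'' hfr'' hI''
      have e0 := hfr''.nvar 0 hc0
      have ex := hfr''.nvar x hcx
      refine Runs.nset ?_ ⟨?_, k + 1, by omega, ?_, hstab _ _ _ hI''⟩
      · simp only [NExpr.Fits]; simp only [NExpr.eval]; omega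
      · simp [hx0, e0, h]
      · simp [NExpr.eval, ex, hxk])
  refine key n s₁ ?_ ⟨h0, 0, by omega, hx1, hI1⟩
  -- The initial assignment writes only `x`, which the loop also writes, so its frame is a frame of
  -- the loop.
  exact ⟨fun y hy => hfr.nvar y (by
      have : x ≠ y := by rintro rfl; simp [Cmd.writesN] at hy
      simpa [Cmd.writesN] using this), fun y _ => hfr.rvar y rfl,
      fun y _ => hfr.narr y rfl, fun y _ => hfr.rarr y rfl⟩

end Rules
end RealRAM

namespace RealRAM
open Finset

/-! ### Keys and blocked pairs for planar points with coordinates `px`, `py` -/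

/-- The slope `κ ≥ 0` for which the vector `(x, y)` is parallel to one of the axes `(1, κ)` and
`(-κ, 1)`. -/
noncomputable def dirKey (x y : ℝ) : ℝ := max (y / x) (-(x / y))

theorem dirKey_neg (x y : ℝ) : dirKey (-x) (-y) = dirKey x y := by simp [dirKey]

/-- The two candidates are negative reciprocals of each other; if a coordinate vanishes, both are 0
by the convention for division by zero. -/
theorem dirKey_nonneg (x y : ℝ) : 0 ≤ dirKey x y := by
  rcases le_total 0 (y / x) with h | h
  · exact h.trans (le_max_left _ _)
  · refine le_trans ?_ (le_max_right _ _)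
    have : x / y = (y / x)⁻¹ := by simp
    rw [this, neg_nonneg]
    exact inv_nonpos.2 h

/-- The key of the pair `i, j`. -/
noncomputable def pairKey (px py : ℕ → ℝ) (i j : ℕ) : ℝ := dirKey (px j - px i) (py j - py i)

/-- The point `m` lies in the closed rectangle with opposite corners `i`, `j` and sides parallel
to `(1, κ)` and `(-κ, 1)`. -/
def Blocks (px py : ℕ → ℝ) (κ : ℝ) (i j m : ℕ) : Prop :=
  i ≠ j ∧ m ≠ i ∧ m ≠ j ∧
    ¬ ((px m - px i + κ * (py m - py i)) * (px j - px m + κ * (py j - py m)) < 0) ∧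
    ¬ ((py m - py i - κ * (px m - px i)) * (py j - py m - κ * (px j - px m)) < 0)

open Classical in
/-- The total weight of the ordered pairs that are blocked according to the table `β`. -/
noncomputable def blockedWeight (n : ℕ) (w : ℕ → ℕ → ℝ) (β : ℕ → ℕ → ℕ → Prop) : ℝ :=
  ∑ p ∈ range n ×ˢ range n, if ∃ m < n, β p.1 p.2 m then w p.1 p.2 else 0

/-! ### The table of blocked triples -/

/-- Coordinate difference of the points in two word variables. -/
def diffE (a x y : ℕ) : RExpr := .sub (.get a (.var y)) (.get a (.var x))

/-- Test for `Blocks`, with the slope in the real variable `0`. -/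
def blocksE (x y z : ℕ) : BExpr :=
  .and (.not (.neq (.var x) (.var y))) (.and (.not (.neq (.var z) (.var x)))
    (.and (.not (.neq (.var z) (.var y))) (.and
      (.not (.rlt (.mul (.add (diffE 0 x z) (.mul (.var 0) (diffE 1 x z)))
        (.add (diffE 0 z y) (.mul (.var 0) (diffE 1 z y)))) (.ofNat (.const 0))))
      (.not (.rlt (.mul (.sub (diffE 1 x z) (.mul (.var 0) (diffE 0 x z)))
        (.sub (diffE 1 z y) (.mul (.var 0) (diffE 0 z y)))) (.ofNat (.const 0)))))))

/-- Index of a pair. -/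
def idxE (x y : ℕ) : NExpr := .add (.mul (.var x) (.var 0)) (.var y)

/-- Index of a triple. -/
def idx3E (x y z : ℕ) : NExpr := .add (.mul (idxE x y) (.var 0)) (.var z)

/-- Recompute the table entry of the triple `x, y, z` for the slope in the real variable `0`.
Word array `2` holds the table, word array `1` the number of points that block a pair, and the real
variable `1` the total weight of blocked pairs. -/
def updateTriple (wE : ℕ → ℕ → RExpr) (x y z : ℕ) : Cmd :=
  .seq (.cond (.nlt (.const 0) (.get 1 (idxE x y))) (.rset 1 (.sub (.var 1) (wE x y))) .skip)
  (.seq (.nput 1 (idxE x y) (.sub (.get 1 (idxE x y)) (.get 2 (idx3E x y z))))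
  (.seq (.cond (blocksE x y z) (.nput 2 (idx3E x y z) (.const 1)) (.nput 2 (idx3E x y z) (.const 0)))
  (.seq (.nput 1 (idxE x y) (.add (.get 1 (idxE x y)) (.get 2 (idx3E x y z))))
  (.cond (.nlt (.const 0) (.get 1 (idxE x y))) (.rset 1 (.add (.var 1) (wE x y))) .skip))))

/-- The input is in place. -/
structure HasInput (n : ℕ) (px py : ℕ → ℝ) (s : State) : Prop where
  size : s.nvar 0 = n
  fst : s.rarr 0 = px
  snd : s.rarr 1 = py

/-- The expressions `wE x y` compute the weight `w` of the pair in the variables `x`, `y`. -/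
structure ComputesWeight (W : ℕ) (px py : ℕ → ℝ) (w : ℕ → ℕ → ℝ) (wE : ℕ → ℕ → RExpr) : Prop where
  eval : ∀ s x y, s.rarr 0 = px → s.rarr 1 = py → (wE x y).eval s = w (s.nvar x) (s.nvar y)
  fits : ∀ s x y, s.nvar x ≤ W → s.nvar y ≤ W → (wE x y).Fits W s

open Classical in
/-- The memory represents the table `β`. -/
structure Represents (n : ℕ) (w : ℕ → ℕ → ℝ) (β : ℕ → ℕ → ℕ → Prop) (s : State) : Prop where
  table : ∀ i < n, ∀ j < n, ∀ m < n, s.narr 2 ((i * n + j) * n + m) = if β i j m then 1 else 0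
  count : ∀ i < n, ∀ j < n, s.narr 1 (i * n + j) = #{m ∈ range n | β i j m}
  weight : s.rvar 1 = blockedWeight n w β

theorem index_inj {n i j i' j' : ℕ} (hj : j < n) (hj' : j' < n) (h : i * n + j = i' * n + j') :
    i = i' ∧ j = j' := by
  have hn : 0 < n := by omega
  have h1 := congrArg (· / n) h
  have h2 := congrArg (· % n) h
  simp only [Nat.add_comm _ j, Nat.add_comm _ j', Nat.add_mul_div_right _ _ hn,
    Nat.add_mul_mod_self_right, Nat.div_eq_of_lt hj, Nat.div_eq_of_lt hj', Nat.mod_eq_of_lt hj,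
    Nat.mod_eq_of_lt hj', zero_add] at h1 h2
  exact ⟨h1, h2⟩

theorem index_lt {n i j : ℕ} {N : ℕ} (hi : i < N) (hj : j < n) : i * n + j < N * n := by
  calc i * n + j < i * n + n := by omega
    _ = (i + 1) * n := by ring
    _ ≤ N * n := Nat.mul_le_mul_right _ hi

/-- Overwrite one entry of a table. -/
def setEntry (β : ℕ → ℕ → ℕ → Prop) (i j m : ℕ) (b : Prop) (i' j' m' : ℕ) : Prop :=
  (i' = i ∧ j' = j ∧ m' = m ∧ b) ∨ (¬ (i' = i ∧ j' = j ∧ m' = m) ∧ β i' j' m')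

open Classical in
-- The contribution of a pair to the weight depends only on whether its count is positive.
-- Subtracting it according to the old count and adding it back according to the new one is
-- therefore a constant-time repair.
theorem Represents.update {n : ℕ} {w : ℕ → ℕ → ℝ} {β : ℕ → ℕ → ℕ → Prop} {s s' : State}
    (h : Represents n w β s) {i j m : ℕ} (hi : i < n) (hj : j < n) (hm : m < n) (b : Prop)
    (h2 : s'.narr 2 = Function.update (s.narr 2) ((i * n + j) * n + m) (if b then 1 else 0))
    (h1 : s'.narr 1 = Function.update (s.narr 1) (i * n + j)
      (s.narr 1 (i * n + j) - s.narr 2 ((i * n + j) * n + m) + if b then 1 else 0))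
    (hD : s'.rvar 1 = s.rvar 1 - (if 0 < s.narr 1 (i * n + j) then w i j else 0)
      + if 0 < s'.narr 1 (i * n + j) then w i j else 0) :
    Represents n w (setEntry β i j m b) s' := by
  obtain ⟨β', hβ'⟩ : ∃ β', setEntry β i j m b = β' := ⟨_, rfl⟩
  rw [hβ']
  have hne {i' j' m' : ℕ} (hh : ¬ (i' = i ∧ j' = j ∧ m' = m)) : β' i' j' m' = β i' j' m' := by
    simp only [← hβ', setEntry, hh, not_false_eq_true, true_and, ← and_assoc, false_and,
      false_or]
  have heq : β' i j m = b := by simp [← hβ', setEntry]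
  have hcount : ∀ i' < n, ∀ j' < n, s'.narr 1 (i' * n + j') = #{m ∈ range n | β' i' j' m} := by
    intro i' hi' j' hj'
    by_cases hij : i' = i ∧ j' = j
    · obtain ⟨rfl, rfl⟩ := hij
      rw [h1, Function.update_self, h.table _ hi _ hj _ hm, h.count _ hi _ hj]
      have hmem : m ∈ range n := mem_range.2 hm
      -- Splitting off the term of `m` isolates the only entry that differs; it also shows that the
      -- old entry is part of the count, so the truncated subtraction is exact.
      have e1 := Finset.card_filter (fun m => β i' j' m) (range n)
      have e2 := Finset.card_filter (fun m => β' i' j' m) (range n)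
      rw [← Finset.add_sum_erase _ _ hmem] at e1 e2
      rw [e1, e2, heq]
      have : ∑ x ∈ (range n).erase m, (if β' i' j' x then 1 else 0)
          = ∑ x ∈ (range n).erase m, (if β i' j' x then 1 else 0) := by
        refine Finset.sum_congr rfl fun x hx => ?_
        rw [hne]
        rintro ⟨-, -, rfl⟩
        simp at hx
      rw [this]
      omega
    · have : i' * n + j' ≠ i * n + j := fun hh => hij (index_inj hj' hj hh)
      rw [h1, Function.update_of_ne this, h.count _ hi' _ hj']
      congr 1
      refine Finset.filter_congr fun x _ => ?_
      rw [hne]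
      tauto
  refine ⟨?_, hcount, ?_⟩
  · intro i' hi' j' hj' m' hm'
    by_cases hijm : i' = i ∧ j' = j ∧ m' = m
    · obtain ⟨rfl, rfl, rfl⟩ := hijm
      rw [h2, Function.update_self, heq]
    · rw [hne hijm, h2, Function.update_of_ne, h.table _ hi' _ hj' _ hm']
      intro hh
      obtain ⟨h3, h4⟩ := index_inj hm' hm hh
      obtain ⟨h5, h6⟩ := index_inj hj' hj h3
      exact hijm ⟨h5, h6, h4⟩
  · have hmem : (i, j) ∈ range n ×ˢ range n := by simp [hi, hj]
    have pos (β : ℕ → ℕ → ℕ → Prop) : (∃ m < n, β i j m) ↔ 0 < #{m ∈ range n | β i j m} := by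
      simp [Finset.card_pos, Finset.filter_nonempty_iff]
    rw [hD, h.weight, h.count _ hi _ hj, hcount _ hi _ hj]
    simp only [blockedWeight]
    rw [← Finset.add_sum_erase _ _ hmem, ← Finset.add_sum_erase (range n ×ˢ range n)
      (fun p => if ∃ m < n, β' p.1 p.2 m then w p.1 p.2 else 0) hmem]
    have : ∑ x ∈ (range n ×ˢ range n).erase (i, j),
        (if ∃ m < n, β' x.1 x.2 m then w x.1 x.2 else 0)
        = ∑ x ∈ (range n ×ˢ range n).erase (i, j),
        (if ∃ m < n, β x.1 x.2 m then w x.1 x.2 else 0) := by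
      refine Finset.sum_congr rfl fun x hx => ?_
      have hx' : ¬ (x.1 = i ∧ x.2 = j) := by
        rintro ⟨rfl, rfl⟩
        simp at hx
      have : ∀ m', β' x.1 x.2 m' = β x.1 x.2 m' := fun m' => hne (by tauto)
      simp only [this]
    rw [this]
    simp only [pos]
    ring

/-- The memory represents a table that is correct for the slope `κ` on the triples in `S`. -/
def CorrectOn (n : ℕ) (px py : ℕ → ℝ) (w : ℕ → ℕ → ℝ) (κ : ℝ) (S : ℕ → ℕ → ℕ → Prop)
    (s : State) : Prop :=
  ∃ β, Represents n w β s ∧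
    ∀ i < n, ∀ j < n, ∀ m < n, S i j m → (β i j m ↔ Blocks px py κ i j m)

/-! ### Correctness of a single table update -/

section Programs
variable {W n : ℕ} {px py : ℕ → ℝ} {w : ℕ → ℕ → ℝ} {wE : ℕ → ℕ → RExpr}

theorem CorrectOn.mono {κ : ℝ} {S S' : ℕ → ℕ → ℕ → Prop} {s : State}
    (h : CorrectOn n px py w κ S s)
    (hS : ∀ i < n, ∀ j < n, ∀ m < n, S' i j m → S i j m) : CorrectOn n px py w κ S' s := by
  obtain ⟨β, hβ, hc⟩ := h
  exact ⟨β, hβ, fun i hi j hj m hm h' => hc i hi j hj m hm (hS i hi j hj m hm h')⟩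

theorem CorrectOn.congr {κ : ℝ} {S : ℕ → ℕ → ℕ → Prop} {s s' : State}
    (h : CorrectOn n px py w κ S s) (h1 : s'.narr 1 = s.narr 1) (h2 : s'.narr 2 = s.narr 2)
    (h3 : s'.rvar 1 = s.rvar 1) : CorrectOn n px py w κ S s' := by
  obtain ⟨β, ⟨a, b, c⟩, hc⟩ := h
  exact ⟨β, ⟨by rwa [h2], by rwa [h1], by rwa [h3]⟩, hc⟩

theorem HasInput.frame {c : Cmd} {s s' : State} (h : HasInput n px py s) (hf : Frame c s s')
    (h0 : c.writesN 0 = false) (h1 : c.writesRA 0 = false) (h2 : c.writesRA 1 = false) :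
    HasInput n px py s' :=
  ⟨(hf.nvar 0 h0).trans h.size, (hf.rarr 0 h1).trans h.fst, (hf.rarr 1 h2).trans h.snd⟩

theorem blocksE_holds {s : State} (h : HasInput n px py s) (x y z : ℕ) :
    (blocksE x y z).Holds s ↔ Blocks px py (s.rvar 0) (s.nvar x) (s.nvar y) (s.nvar z) := by
  simp [blocksE, BExpr.Holds, NExpr.eval, RExpr.eval, diffE, Blocks, h.fst, h.snd]

theorem blocksE_fits {s : State} {x y z : ℕ} (hx : s.nvar x ≤ W) (hy : s.nvar y ≤ W)
    (hz : s.nvar z ≤ W) : (blocksE x y z).Fits W s := by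
  simp [blocksE, BExpr.Fits, NExpr.Fits, RExpr.Fits, diffE, hx, hy, hz]

theorem idxE_eval {s : State} (h : s.nvar 0 = n) (x y : ℕ) :
    (idxE x y).eval s = s.nvar x * n + s.nvar y := by simp [idxE, NExpr.eval, h]

theorem idx3E_eval {s : State} (h : s.nvar 0 = n) (x y z : ℕ) :
    (idx3E x y z).eval s = (s.nvar x * n + s.nvar y) * n + s.nvar z := by
  simp [idx3E, NExpr.eval, h, idxE_eval h]

theorem idx3E_fits {s : State} (hW : (n + 1) ^ 3 ≤ W) (h : s.nvar 0 = n) {x y z : ℕ}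
    (hx : s.nvar x < n) (hy : s.nvar y < n) (hz : s.nvar z < n) :
    (idxE x y).Fits W s ∧ (idx3E x y z).Fits W s := by
  have h1 : s.nvar x * n + s.nvar y < n * n := index_lt hx hy
  have h2 : (s.nvar x * n + s.nvar y) * n + s.nvar z < n * n * n := index_lt h1 hz
  have h3 : n * n * n ≤ W := le_trans (by ring_nf; omega) hW
  have h4 : n * n ≤ W := le_trans (by ring_nf; omega) hW
  have h5 : n ≤ W := le_trans (by ring_nf; omega) hW
  have : (idxE x y).Fits W s := by
    simp only [idxE, NExpr.Fits, NExpr.eval, h]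
    omega
  refine ⟨this, ?_⟩
  simp only [idx3E, NExpr.Fits, NExpr.eval, h, idxE_eval h, this, true_and]
  omega

/-- The old entry may be right or wrong: only the mutual consistency of table, counts and weight is
used. The same routine can therefore fill the table and repair it. -/
theorem updateTriple_runs (hw : ComputesWeight W px py w wE) (hW : (n + 1) ^ 3 ≤ W) {s : State}
    (hin : HasInput n px py s) {x y z : ℕ} {S : ℕ → ℕ → ℕ → Prop}
    (hx : s.nvar x < n) (hy : s.nvar y < n) (hz : s.nvar z < n)
    (h : CorrectOn n px py w (s.rvar 0) S s) :
    Runs W (updateTriple wE x y z) s ((updateTriple wE x y z).time n)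
      (CorrectOn n px py w (s.rvar 0)
        fun i j m => S i j m ∨ (i = s.nvar x ∧ j = s.nvar y ∧ m = s.nvar z)) := by
  classical
  obtain ⟨β, hβ, hS⟩ := h
  have hnW : n + 1 ≤ W := le_trans (by ring_nf; omega) hW
  have hc0 := hβ.count _ hx _ hy
  have ht0 := hβ.table _ hx _ hy _ hz
  obtain ⟨i, hi⟩ : ∃ i, s.nvar x = i := ⟨_, rfl⟩
  obtain ⟨j, hj⟩ : ∃ j, s.nvar y = j := ⟨_, rfl⟩
  obtain ⟨m, hm⟩ : ∃ m, s.nvar z = m := ⟨_, rfl⟩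
  simp only [hi, hj, hm] at hx hy hz hc0 ht0 ⊢
  have hcn : s.narr 1 (i * n + j) ≤ n := by
    rw [hc0]
    exact (Finset.card_filter_le _ _).trans (by simp)
  have htn : s.narr 2 ((i * n + j) * n + m) ≤ 1 := by rw [ht0]; split_ifs <;> simp
  have hle : s.narr 2 ((i * n + j) * n + m) ≤ s.narr 1 (i * n + j) := by
    rw [hc0, ht0]
    split_ifs with hb
    · exact Finset.card_pos.2 ⟨m, by simp [hb, hz]⟩
    · simp
  obtain ⟨c0, hc0'⟩ : ∃ c, s.narr 1 (i * n + j) = c := ⟨_, rfl⟩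
  obtain ⟨t0, ht0'⟩ : ∃ c, s.narr 2 ((i * n + j) * n + m) = c := ⟨_, rfl⟩
  obtain ⟨B, hB⟩ : ∃ B, Blocks px py (s.rvar 0) i j m = B := ⟨_, rfl⟩
  rw [hc0'] at hcn hle
  rw [ht0'] at htn hle
  -- Index expressions read word variables only, and no substep writes these, so one evaluation
  -- serves all intermediate memories.
  have aux : ∀ s' : State, s'.nvar = s.nvar → (idxE x y).Fits W s' ∧ (idx3E x y z).Fits W s' ∧
      (idxE x y).eval s' = i * n + j ∧ (idx3E x y z).eval s' = (i * n + j) * n + m := by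
    intro s' hs'
    have h0 : s'.nvar 0 = n := by rw [hs', hin.size]
    have := idx3E_fits hW h0 (x := x) (y := y) (z := z) (by rw [hs', hi]; exact hx)
      (by rw [hs', hj]; exact hy) (by rw [hs', hm]; exact hz)
    refine ⟨this.1, this.2, ?_, ?_⟩
    · rw [idxE_eval h0, hs', hi, hj]
    · rw [idx3E_eval h0, hs', hi, hj, hm]
  unfold updateTriple
  obtain ⟨f1, f2, e1, e2⟩ := aux s rfl
  refine Runs.seq (R := fun s' => s'.rvar 1 = s.rvar 1 - if 0 < c0 then w i j else 0) ?_ ?_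
  · refine Runs.cond ?_ (fun hb => Runs.rset ?_ ?_) (fun hb => Runs.skip ?_)
    · simp only [BExpr.Fits, NExpr.Fits, f1, e1, hc0', true_and]
      omega
    · exact ⟨trivial, hw.fits s x y (by omega) (by omega)⟩
    · simp only [BExpr.Holds, NExpr.eval, e1, hc0'] at hb
      simp [RExpr.eval, hw.eval s x y hin.fst hin.snd, hb, hi, hj]
    · simp only [BExpr.Holds, NExpr.eval, e1, hc0'] at hb
      simp [hb]
  intro s1 F1 r1
  have n1 : s1.nvar = s.nvar := funext fun v => F1.nvar v rfl
  have a1 : s1.narr = s.narr := funext fun v => F1.narr v rfl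
  have v1 : s1.rvar 0 = s.rvar 0 := F1.rvar 0 rfl
  have b1 : s1.rarr = s.rarr := funext fun v => F1.rarr v rfl
  obtain ⟨f1, f2, e1, e2⟩ := aux s1 n1
  refine Runs.seq (R := fun s' => s'.narr 1 = Function.update (s.narr 1) (i * n + j) (c0 - t0))
    (Runs.nput f1 ?_ ?_) ?_
  · simp only [NExpr.Fits, f1, f2, e1, e2, a1, hc0', ht0', true_and]
    omega
  · simp [NExpr.eval, e1, e2, a1, hc0', ht0']
  intro s2 F2 r2
  have n2 : s2.nvar = s.nvar := (funext fun v => F2.nvar v rfl).trans n1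
  have a2 : s2.narr 2 = s.narr 2 := (F2.narr 2 rfl).trans (by rw [a1])
  have v2 : s2.rvar = s1.rvar := funext fun v => F2.rvar v rfl
  have b2 : s2.rarr = s.rarr := (funext fun v => F2.rarr v rfl).trans b1
  obtain ⟨f1, f2, e1, e2⟩ := aux s2 n2
  have in2 : HasInput n px py s2 := ⟨by rw [n2, hin.size], by rw [b2, hin.fst], by rw [b2, hin.snd]⟩
  have hb2 := blocksE_holds in2 x y z
  rw [n2, v2, v1, hi, hj, hm, hB] at hb2
  refine Runs.seq (R := fun s' => s'.narr 2 = Function.update (s.narr 2) ((i * n + j) * n + m)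
    (if B then 1 else 0)) ?_ ?_
  · refine Runs.cond (blocksE_fits (by rw [n2]; omega) (by rw [n2]; omega) (by rw [n2]; omega))
      (fun hb => Runs.nput f2 ?_ ?_) (fun hb => Runs.nput f2 ?_ ?_)
    · simp only [NExpr.Fits]; omega
    · rw [hb2] at hb
      simp [NExpr.eval, e2, a2, hb]
    · simp [NExpr.Fits]
    · rw [hb2] at hb
      simp [NExpr.eval, e2, a2, hb]
  intro s3 F3 r3
  have n3 : s3.nvar = s.nvar := (funext fun v => F3.nvar v rfl).trans n2
  have a3 : s3.narr 1 = Function.update (s.narr 1) (i * n + j) (c0 - t0) := (F3.narr 1 rfl).trans r2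
  have v3 : s3.rvar = s1.rvar := (funext fun v => F3.rvar v rfl).trans v2
  have b3 : s3.rarr = s.rarr := (funext fun v => F3.rarr v rfl).trans b2
  obtain ⟨f1, f2, e1, e2⟩ := aux s3 n3
  have hB1 : (if B then 1 else 0 : ℕ) ≤ 1 := by split_ifs <;> simp
  refine Runs.seq (R := fun s' => s'.narr 1 = Function.update (s.narr 1) (i * n + j)
    (c0 - t0 + if B then 1 else 0)) (Runs.nput f1 ?_ ?_) ?_
  · simp only [NExpr.Fits, f1, f2, e1, e2, a3, r3, NExpr.eval, Function.update_self, true_and]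
    omega
  · simp only [NExpr.eval, e1, e2, a3, r3, Function.update_self, Function.update_idem]
  intro s4 F4 r4
  have n4 : s4.nvar = s.nvar := (funext fun v => F4.nvar v rfl).trans n3
  have a4 : s4.narr 2 = _ := (F4.narr 2 rfl).trans r3
  have v4 : s4.rvar = s1.rvar := (funext fun v => F4.rvar v rfl).trans v3
  have b4 : s4.rarr = s.rarr := (funext fun v => F4.rarr v rfl).trans b3
  obtain ⟨f1, f2, e1, e2⟩ := aux s4 n4
  have in4 : HasInput n px py s4 := ⟨by rw [n4, hin.size], by rw [b4, hin.fst], by rw [b4, hin.snd]⟩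
  have g4 : s4.narr 1 (i * n + j) = c0 - t0 + if B then 1 else 0 := by
    rw [r4, Function.update_self]
  have main : Runs W (.cond (.nlt (.const 0) (.get 1 (idxE x y)))
      (.rset 1 (.add (.var 1) (wE x y))) .skip) s4 (Cmd.time n (.cond
        (.nlt (.const 0) (.get 1 (idxE x y))) (.rset 1 (.add (.var 1) (wE x y))) .skip))
      (fun s' => s'.rvar 1 = s1.rvar 1 + if 0 < s4.narr 1 (i * n + j) then w i j else 0) := by
    refine Runs.cond ?_ (fun hb => Runs.rset ?_ ?_) (fun hb => Runs.skip ?_)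
    · simp only [BExpr.Fits, NExpr.Fits, f1, e1, g4, true_and]
      omega
    · exact ⟨trivial, hw.fits s4 x y (by rw [n4]; omega) (by rw [n4]; omega)⟩
    · simp only [BExpr.Holds, NExpr.eval, e1] at hb
      simp [RExpr.eval, hw.eval s4 x y in4.fst in4.snd, hb, n4, v4, hi, hj]
    · simp only [BExpr.Holds, NExpr.eval, e1] at hb
      simp [v4, hb]
  refine main.imp fun s5 F5 r5 => ?_
  have a5 : s5.narr = s4.narr := funext fun v => F5.narr v rfl
  refine ⟨_, hβ.update hx hy hz B (by rw [a5, a4]) (by rw [a5, r4, hc0', ht0'])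
    (by rw [r5, r1, a5, hc0']), ?_⟩
  intro i' hi' j' hj' m' hm' hSS
  by_cases hijm : i' = i ∧ j' = j ∧ m' = m
  · obtain ⟨rfl, rfl, rfl⟩ := hijm
    simp [setEntry, hB]
  · rw [show setEntry β i j m B i' j' m' ↔ β i' j' m' by unfold setEntry; tauto]
    exact hS i' hi' j' hj' m' hm' (hSS.resolve_right hijm)

end Programs
end RealRAM

namespace RealRAM
open Finset

/-! ### The rotational sweep -/

/-- Recompute all triples that have `x, y` as a corner and the inner point. -/
def updateTouching (wE : ℕ → ℕ → RExpr) (x y : ℕ) : Cmd :=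
  .forN 10 (.seq (updateTriple wE x 10 y) (.seq (updateTriple wE y 10 x)
    (.seq (updateTriple wE 10 x y) (updateTriple wE 10 y x))))

/-- Recompute the whole table. -/
def updateAll (wE : ℕ → ℕ → RExpr) : Cmd :=
  .forN 1 (.forN 2 (.forN 3 (updateTriple wE 1 2 3)))

/-- The key of a pair of indices. -/
def keyE (e f : NExpr) : RExpr :=
  let dx := RExpr.sub (.get 0 f) (.get 0 e)
  let dy := RExpr.sub (.get 1 f) (.get 1 e)
  let u := RExpr.div dy dx
  let v := RExpr.sub (.ofNat (.const 0)) (.div dx dy)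
  .div (.add (.add u v) (.sqrt (.mul (.sub u v) (.sub u v)))) (.ofNat (.const 2))

/-- Word array `3` receives, at the row in the variable `x`, the column of the least key of that
row above the real variable `0`, or `n` if there is none. -/
def scanRow (x : ℕ) : Cmd :=
  .seq (.nset 4 (.var 0)) (.seq
    (.forN 2 (.cond (.and (.nlt (.var x) (.var 2)) (.and (.rlt (.var 0) (keyE (.var x) (.var 2)))
      (.or (.neq (.var 4) (.var 0)) (.rlt (keyE (.var x) (.var 2)) (keyE (.var x) (.var 4))))))
      (.nset 4 (.var 2)) .skip))
    (.nput 3 (.var x) (.var 4)))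

/-- Word variable `5` receives the row whose candidate has the least key, or `n`. -/
def pickRow : Cmd :=
  .seq (.nset 5 (.var 0))
    (.forN 1 (.cond (.neq (.get 3 (.var 1)) (.var 0)) .skip
      (.cond (.neq (.var 5) (.var 0)) (.nset 5 (.var 1))
        (.cond (.rlt (keyE (.var 1) (.get 3 (.var 1))) (keyE (.var 5) (.get 3 (.var 5))))
          (.nset 5 (.var 1)) .skip))))

/-- Go to the next key: the current pair moves to the variables `8, 9`, the next pair to `6, 7`. -/
def advance : Cmd :=
  .seq (.nset 8 (.var 6)) (.seq (.nset 9 (.var 7)) (.seq (.nset 6 (.var 5))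
    (.seq (.nset 7 (.get 3 (.var 6))) (.rset 0 (keyE (.var 6) (.var 7))))))

/-- Keep the best slope seen so far in the real variable `3`, its value in `2`. -/
def recordBest : Cmd :=
  .cond (.rlt (.var 2) (.var 1)) (.seq (.rset 2 (.var 1)) (.rset 3 (.var 0))) .skip

/-- One round of the sweep. -/
def sweepStep (wE : ℕ → ℕ → RExpr) : Cmd :=
  .seq advance (.seq (updateTouching wE 8 9) (.seq (updateTouching wE 6 7)
    (.seq recordBest (.seq (scanRow 6) pickRow))))

/-- Write the adjacency matrix. -/
def writeGraph : Cmd :=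
  .forN 1 (.forN 2 (.cond (.and (.not (.neq (.var 1) (.var 2))) (.neq (.get 1 (idxE 1 2)) (.const 0)))
    (.nput 0 (idxE 1 2) (.const 1)) (.nput 0 (idxE 1 2) (.const 0))))

/-- Everything before the sweep. -/
def sweepInit (wE : ℕ → ℕ → RExpr) : Cmd :=
  .seq (updateAll wE) (.seq (.rset 2 (.var 1))
    (.seq (.rset 0 (.sub (.ofNat (.const 0)) (.ofNat (.const 1))))
      (.seq (.forN 1 (scanRow 1)) pickRow)))

/-- Everything after the sweep. -/
def sweepFinish (wE : ℕ → ℕ → RExpr) : Cmd :=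
  .seq (.rset 0 (.var 3)) (.seq (updateAll wE) writeGraph)

/-- The sweep over all keys. -/
def sweepLoop (wE : ℕ → ℕ → RExpr) : Cmd := .loop (.nlt (.var 5) (.var 0)) (sweepStep wE)

/-- The complete program. -/
def sweep (wE : ℕ → ℕ → RExpr) : Cmd :=
  .seq (sweepInit wE) (.seq (sweepLoop wE) (sweepFinish wE))

/-! ### Correctness of the subroutines of the sweep -/

section Programs
variable {W n : ℕ} {px py : ℕ → ℝ} {w : ℕ → ℕ → ℝ} {wE : ℕ → ℕ → RExpr}

/-- The pair `a, b` consists of a corner and the inner point of the triple. -/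
def Touches (a b i j m : ℕ) : Prop :=
  (i = a ∧ m = b) ∨ (i = b ∧ m = a) ∨ (j = a ∧ m = b) ∨ (j = b ∧ m = a)

theorem succ_le_of_pow_le (hW : (n + 1) ^ 3 ≤ W) : n + 1 ≤ W := le_trans (by ring_nf; omega) hW

theorem updateTriple_frame {c s s'} {x y z : ℕ} (hc : c = updateTriple wE x y z)
    (h : Frame c s s') : s'.nvar = s.nvar ∧ s'.rvar 0 = s.rvar 0 ∧ s'.rarr = s.rarr := by
  subst hc
  exact ⟨funext fun v => h.nvar v rfl, h.rvar 0 rfl, funext fun v => h.rarr v rfl⟩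

/-- With a corner and the inner point prescribed, only the other corner is free. Four assignments of
roles in each of `n` rounds cover all such triples in linear time. -/
theorem updateTouching_runs (hw : ComputesWeight W px py w wE) (hW : (n + 1) ^ 3 ≤ W) {s : State}
    (hin : HasInput n px py s) {x y : ℕ} {S : ℕ → ℕ → ℕ → Prop} (hx10 : (10 == x) = false)
    (hy10 : (10 == y) = false) {a b : ℕ} (ha : s.nvar x = a) (hb : s.nvar y = b)
    (hx : a < n) (hy : b < n) (h : CorrectOn n px py w (s.rvar 0) S s) :
    Runs W (updateTouching wE x y) s ((updateTouching wE x y).time n)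
      (CorrectOn n px py w (s.rvar 0) fun i j m => S i j m ∨ Touches a b i j m) := by
  obtain ⟨κ, hκ⟩ : ∃ κ, s.rvar 0 = κ := ⟨_, rfl⟩
  rw [hκ] at h ⊢
  refine (Runs.forN (I := fun k => CorrectOn n px py w κ fun i j m => S i j m ∨
    (i = a ∧ m = b ∧ j < k) ∨ (i = b ∧ m = a ∧ j < k) ∨ (j = a ∧ m = b ∧ i < k) ∨
      (j = b ∧ m = a ∧ i < k)) rfl rfl rfl hin.size (succ_le_of_pow_le hW)
    (fun k s v hI => hI.congr rfl rfl rfl) (h.mono ?_) ?_).imp ?_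
  · intro i _ j _ m _ h
    simpa using h
  · intro k s1 hk h10 F1 h1
    have x1 : s1.nvar x = a :=
      (F1.nvar x (by simpa [Cmd.forN, Cmd.writesN, updateTriple] using hx10)).trans ha
    have y1 : s1.nvar y = b :=
      (F1.nvar y (by simpa [Cmd.forN, Cmd.writesN, updateTriple] using hy10)).trans hb
    have κ1 : s1.rvar 0 = κ := (F1.rvar 0 rfl).trans hκ
    have in1 : HasInput n px py s1 := hin.frame F1 rfl rfl rfl
    refine Runs.seq (updateTriple_runs hw hW in1 (by omega) (by omega) (by omega)
      (by rw [κ1]; exact h1)) fun s2 F2 h2 => ?_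
    obtain ⟨n2, κ2, b2⟩ := updateTriple_frame rfl F2
    have in2 : HasInput n px py s2 := in1.frame F2 rfl rfl rfl
    refine Runs.seq (updateTriple_runs hw hW in2 (by rw [n2]; omega) (by rw [n2]; omega)
      (by rw [n2]; omega) (by rw [κ2]; exact h2)) fun s3 F3 h3 => ?_
    obtain ⟨n3, κ3, b3⟩ := updateTriple_frame rfl F3
    have in3 : HasInput n px py s3 := in2.frame F3 rfl rfl rfl
    rw [n2] at n3
    refine Runs.seq (updateTriple_runs hw hW in3 (by rw [n3]; omega) (by rw [n3]; omega)
      (by rw [n3]; omega) (by rw [κ3]; exact h3)) fun s4 F4 h4 => ?_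
    obtain ⟨n4, κ4, b4⟩ := updateTriple_frame rfl F4
    have in4 : HasInput n px py s4 := in3.frame F4 rfl rfl rfl
    rw [n3] at n4
    refine (updateTriple_runs hw hW in4 (by rw [n4]; omega) (by rw [n4]; omega)
      (by rw [n4]; omega) (by rw [κ4]; exact h4)).imp fun s5 F5 h5 => ?_
    rw [κ4, κ3, κ2, κ1] at h5
    refine h5.mono fun i _ j _ m _ hS => ?_
    rw [n4, n3, n2, x1, y1, h10]
    rcases hS with hS | ⟨h1, h2, h3⟩ | ⟨h1, h2, h3⟩ | ⟨h1, h2, h3⟩ | ⟨h1, h2, h3⟩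
    · simp [hS]
    all_goals rcases Nat.lt_succ_iff_lt_or_eq.1 h3 with h3 | h3 <;> simp [h1, h2, h3]
  · intro s' _ h'
    refine h'.mono fun i _ j _ m _ hS => ?_
    rcases hS with hS | ⟨h1, h2⟩ | ⟨h1, h2⟩ | ⟨h1, h2⟩ | ⟨h1, h2⟩
    · exact Or.inl hS
    all_goals simp [*]

/-- The set `S` of trusted triples is arbitrary, possibly empty. This allows both the first filling
of the table and its rebuilding at the chosen slope, where cubic time is affordable. -/
theorem updateAll_runs (hw : ComputesWeight W px py w wE) (hW : (n + 1) ^ 3 ≤ W) {s : State}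
    (hin : HasInput n px py s) {S : ℕ → ℕ → ℕ → Prop} (h : CorrectOn n px py w (s.rvar 0) S s) :
    Runs W (updateAll wE) s ((updateAll wE).time n)
      (CorrectOn n px py w (s.rvar 0) fun _ _ _ => True) := by
  obtain ⟨κ, hκ⟩ : ∃ κ, s.rvar 0 = κ := ⟨_, rfl⟩
  rw [hκ] at h ⊢
  have hW' := succ_le_of_pow_le hW
  refine (Runs.forN (I := fun a => CorrectOn n px py w κ fun i _ _ => i < a) rfl rfl rfl hin.size
    hW' (fun k s v hI => hI.congr rfl rfl rfl) (h.mono ?_) ?_).imp ?_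
  · simp
  · intro a s1 ha h1 F1 C1
    have in1 : HasInput n px py s1 := hin.frame F1 rfl rfl rfl
    refine (Runs.forN (I := fun b => CorrectOn n px py w κ fun i j _ => i < a ∨ (i = a ∧ j < b))
      rfl rfl rfl in1.size hW' (fun k s v hI => hI.congr rfl rfl rfl) (C1.mono ?_) ?_).imp ?_
    · simp
    · intro b s2 hb h2 F2 C2
      have in2 : HasInput n px py s2 := in1.frame F2 rfl rfl rfl
      refine (Runs.forN (I := fun c => CorrectOn n px py w κ fun i j m =>
          i < a ∨ (i = a ∧ j < b) ∨ (i = a ∧ j = b ∧ m < c))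
        rfl rfl rfl in2.size hW' (fun k s v hI => hI.congr rfl rfl rfl) (C2.mono ?_) ?_).imp ?_
      · simp
      · intro c s3 hc h3 F3 C3
        have in3 : HasInput n px py s3 := in2.frame F3 rfl rfl rfl
        have e1 : s3.nvar 1 = a := by rw [F3.nvar 1 rfl, F2.nvar 1 rfl, h1]
        have e2 : s3.nvar 2 = b := by rw [F3.nvar 2 rfl, h2]
        have e0 : s3.rvar 0 = κ := by rw [F3.rvar 0 rfl, F2.rvar 0 rfl, F1.rvar 0 rfl, hκ]
        refine (updateTriple_runs hw hW in3 (by omega) (by omega) (by omega)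
          (by rw [e0]; exact C3)).imp fun s4 F4 C4 => ?_
        rw [e0] at C4
        refine C4.mono fun i _ j _ m _ hS => ?_
        rw [e1, e2, h3]
        omega
      · intro s' _ h'
        refine h'.mono fun i _ j _ m _ hS => ?_
        omega
    · intro s' _ h'
      refine h'.mono fun i _ j _ m _ hS => ?_
      omega
  · intro s' _ h'
    exact h'.mono fun i hi j _ m _ hS => hi

/-- The real expressions have no maximum, so it is written as `(u + v + |u - v|) / 2`, with the
absolute value as the root of a square. -/
theorem keyE_eval {s : State} (hin : HasInput n px py s) (e f : NExpr) :
    (keyE e f).eval s = pairKey px py (e.eval s) (f.eval s) := by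
  simp only [keyE, RExpr.eval, hin.fst, hin.snd, NExpr.eval, pairKey, dirKey, Nat.cast_zero,
    zero_sub, Real.sqrt_mul_self_eq_abs, Nat.cast_ofNat]
  rw [max_def]
  split_ifs with h
  · rw [abs_of_nonpos (by linarith)]; ring
  · rw [abs_of_nonneg (by linarith)]; ring

theorem keyE_fits {s : State} {e f : NExpr} (he : e.Fits W s) (hf : f.Fits W s) (hW : 2 ≤ W) :
    (keyE e f).Fits W s := by
  simp [keyE, RExpr.Fits, NExpr.Fits, he, hf, hW]

/-- `c` is the column of the least key above `κ` among the first `k` entries of row `i`, or `n` if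
there is none. -/
def IsRowMin (n : ℕ) (px py : ℕ → ℝ) (κ : ℝ) (i k c : ℕ) : Prop :=
  (c = n ∧ ∀ j < k, i < j → pairKey px py i j ≤ κ) ∨
  (c < n ∧ i < c ∧ κ < pairKey px py i c ∧
    ∀ j < k, i < j → κ < pairKey px py i j → pairKey px py i c ≤ pairKey px py i j)

theorem scanRow_runs (hW : n + 1 ≤ W) {s : State} (hin : HasInput n px py s) {x i : ℕ}
    (hx2 : (2 == x) = false) (hx4 : (4 == x) = false) (hx : s.nvar x = i) (hi : i < n) :
    Runs W (scanRow x) s ((scanRow x).time n) (fun s' => ∃ c, IsRowMin n px py (s.rvar 0) i n c ∧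
      s'.narr 3 = Function.update (s.narr 3) i c) := by
  have ne2 : x ≠ 2 := by rintro rfl; simp at hx2
  have ne4 : x ≠ 4 := by rintro rfl; simp at hx4
  refine Runs.seq (R := fun s' => s'.nvar 4 = n) (Runs.nset ?_ ?_) ?_
  · simp only [NExpr.Fits, hin.size]; omega
  · simp [NExpr.eval, hin.size]
  intro s1 F1 c1
  have in1 : HasInput n px py s1 := hin.frame F1 rfl rfl rfl
  have x1 : s1.nvar x = i := (F1.nvar x (by simpa [Cmd.writesN] using hx4)).trans hx
  have κ1 : s1.rvar 0 = s.rvar 0 := F1.rvar 0 rfl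
  have a1 : s1.narr 3 = s.narr 3 := F1.narr 3 rfl
  refine Runs.seq (Runs.forN (I := fun k s' => IsRowMin n px py (s.rvar 0) i k (s'.nvar 4))
    rfl rfl rfl in1.size hW ?_ ?_ ?_) ?_
  · intro k s' v h
    simpa using h
  · exact Or.inl ⟨c1, by simp⟩
  · intro k s2 hk h2 F2 h
    have in2 : HasInput n px py s2 := in1.frame F2 rfl rfl rfl
    have x2 : s2.nvar x = i := (F2.nvar x (by
      simp [Cmd.forN, Cmd.writesN]; omega)).trans x1
    have κ2 : s2.rvar 0 = s.rvar 0 := (F2.rvar 0 rfl).trans κ1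
    have hc : s2.nvar 4 ≤ n := by
      rcases h with h | h <;> omega
    have f1 : NExpr.Fits W s2 (.var x) := by simp only [NExpr.Fits]; omega
    have f2 : NExpr.Fits W s2 (.var 2) := by simp only [NExpr.Fits]; omega
    -- Variable `4` may still be the sentinel `n`. `Fits` makes no exception for short-circuiting,
    -- so this index must fit even then; the value read there is irrelevant because the test for the
    -- sentinel already holds.
    have f3 : NExpr.Fits W s2 (.var 4) := by simp only [NExpr.Fits]; omega
    have f4 : NExpr.Fits W s2 (.var 0) := by simp only [NExpr.Fits, in2.size]; omega
    have hW2 : 2 ≤ W := by omega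
    refine Runs.cond ?_ (fun hb => Runs.nset f2 ?_) (fun hb => Runs.skip ?_)
    · exact ⟨⟨f1, f2⟩, ⟨trivial, keyE_fits f1 f2 hW2⟩, ⟨f3, f4⟩,
        keyE_fits f1 f2 hW2, keyE_fits f1 f3 hW2⟩
    · simp only [BExpr.Holds, NExpr.eval, keyE_eval in2, RExpr.eval, x2, h2, κ2, in2.size] at hb
      obtain ⟨hik, hlt, hor⟩ := hb
      simp only [NExpr.eval, Function.update_self, h2]
      refine Or.inr ⟨hk, hik, hlt, fun j hj hij hκj => ?_⟩
      rcases Nat.lt_succ_iff_lt_or_eq.1 hj with hj | rfl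
      · rcases h with ⟨-, h⟩ | ⟨h3, -, -, h⟩
        · exact absurd hκj (not_lt.2 (h j hj hij))
        · exact ((hor.resolve_left h3.ne).le).trans (h j hj hij hκj)
      · exact le_rfl
    · simp only [BExpr.Holds, NExpr.eval, keyE_eval in2, RExpr.eval, x2, h2, κ2, in2.size] at hb
      rcases h with ⟨h3, h⟩ | ⟨h3, h4, h5, h⟩
      · refine Or.inl ⟨h3, fun j hj hij => ?_⟩
        rcases Nat.lt_succ_iff_lt_or_eq.1 hj with hj | rfl
        · exact h j hj hij
        · by_contra hlt
          exact hb ⟨hij, not_le.1 hlt, Or.inl h3⟩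
      · refine Or.inr ⟨h3, h4, h5, fun j hj hij hκj => ?_⟩
        rcases Nat.lt_succ_iff_lt_or_eq.1 hj with hj | rfl
        · exact h j hj hij hκj
        · by_contra hlt
          exact hb ⟨hij, hκj, Or.inr (not_le.1 hlt)⟩
  · intro s3 F3 h
    have x3 : s3.nvar x = i := (F3.nvar x (by
      simp [Cmd.forN, Cmd.writesN]; omega)).trans x1
    refine Runs.nput ?_ ?_ ⟨s3.nvar 4, h, ?_⟩
    · simp only [NExpr.Fits]; omega
    · simp only [NExpr.Fits]
      rcases h with h | h <;> omega
    · have a3 : s3.narr 3 = s1.narr 3 := F3.narr 3 rfl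
      simp [NExpr.eval, x3, a3, a1]

/-- `r` is the row of the least candidate among the first `k` rows, or `n` if there is none. -/
def IsPick (n : ℕ) (px py : ℕ → ℝ) (cand : ℕ → ℕ) (k r : ℕ) : Prop :=
  (r = n ∧ ∀ i < k, cand i = n) ∨
  (r < n ∧ cand r ≠ n ∧
    ∀ i < k, cand i ≠ n → pairKey px py r (cand r) ≤ pairKey px py i (cand i))

/-- Each row already stores its own least pending key, so the overall minimum needs only `n`
comparisons and no sorting of all keys. -/
theorem pickRow_runs (hW : n + 1 ≤ W) {s : State} (hin : HasInput n px py s)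
    (hcand : ∀ i < n, s.narr 3 i ≤ n) :
    Runs W pickRow s (pickRow.time n) (fun s' => IsPick n px py (s.narr 3) n (s'.nvar 5)) := by
  refine Runs.seq (R := fun s' => s'.nvar 5 = n) (Runs.nset ?_ ?_) ?_
  · simp only [NExpr.Fits, hin.size]; omega
  · simp [NExpr.eval, hin.size]
  intro s1 F1 c1
  have in1 : HasInput n px py s1 := hin.frame F1 rfl rfl rfl
  refine Runs.forN (I := fun k s' => IsPick n px py (s.narr 3) k (s'.nvar 5))
    rfl rfl rfl in1.size hW ?_ ?_ ?_
  · intro k s' v h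
    simpa using h
  · exact Or.inl ⟨c1, by simp⟩
  intro k s2 hk h2 F2 h
  have in2 : HasInput n px py s2 := in1.frame F2 rfl rfl rfl
  have a2 : s2.narr 3 = s.narr 3 := (F2.narr 3 rfl).trans (F1.narr 3 rfl)
  have hck := hcand k hk
  have f0 : NExpr.Fits W s2 (.var 0) := by simp only [NExpr.Fits, in2.size]; omega
  have f1 : NExpr.Fits W s2 (.var 1) := by simp only [NExpr.Fits]; omega
  have f3 : NExpr.Fits W s2 (.get 3 (.var 1)) := by
    simp only [NExpr.Fits, NExpr.eval, h2, a2]; omega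
  refine Runs.cond ⟨f3, f0⟩ (fun hb => Runs.skip ?_) fun hb => ?_
  · simp only [BExpr.Holds, NExpr.eval, h2, a2, in2.size] at hb
    rcases h with ⟨h3, h⟩ | ⟨h3, h4, h⟩
    · refine Or.inl ⟨h3, fun i hi => ?_⟩
      rcases Nat.lt_succ_iff_lt_or_eq.1 hi with hi | rfl
      exacts [h i hi, hb]
    · refine Or.inr ⟨h3, h4, fun i hi hne => ?_⟩
      rcases Nat.lt_succ_iff_lt_or_eq.1 hi with hi | rfl
      exacts [h i hi hne, absurd hb hne]
  simp only [BExpr.Holds, NExpr.eval, h2, a2, in2.size] at hb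
  have f5 : NExpr.Fits W s2 (.var 5) := by
    simp only [NExpr.Fits]
    rcases h with h | h <;> omega
  refine Runs.cond ⟨f5, f0⟩ (fun hb' => Runs.nset f1 ?_) fun hb' => ?_
  · simp only [BExpr.Holds, NExpr.eval, in2.size] at hb'
    simp only [NExpr.eval, Function.update_self, h2]
    rcases h with ⟨h3, h⟩ | ⟨h3, -, -⟩
    · refine Or.inr ⟨hk, hb, fun i hi hne => ?_⟩
      rcases Nat.lt_succ_iff_lt_or_eq.1 hi with hi | rfl
      exacts [absurd (h i hi) hne, le_rfl]
    · omega
  simp only [BExpr.Holds, NExpr.eval, in2.size] at hb'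
  rcases h with ⟨h3, h⟩ | ⟨h3, h4, h⟩
  · exact absurd h3 hb'
  have hcr := hcand _ h3
  -- The entry of array `3` at the sentinel `n` is not controlled. The sentinel is tested in an
  -- earlier branch, so here the row is below `n` and `hcand` bounds the entry.
  have f6 : NExpr.Fits W s2 (.get 3 (.var 5)) := by
    refine ⟨f5, ?_⟩
    simp only [NExpr.eval, a2]; omega
  refine Runs.cond ⟨keyE_fits f1 f3 (by omega), keyE_fits f5 f6 (by omega)⟩
    (fun hb'' => Runs.nset f1 ?_) fun hb'' => Runs.skip ?_
  · simp only [BExpr.Holds, keyE_eval in2, NExpr.eval, h2, a2] at hb''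
    simp only [NExpr.eval, Function.update_self, h2]
    refine Or.inr ⟨hk, hb, fun i hi hne => ?_⟩
    rcases Nat.lt_succ_iff_lt_or_eq.1 hi with hi | rfl
    exacts [hb''.le.trans (h i hi hne), le_rfl]
  · simp only [BExpr.Holds, keyE_eval in2, NExpr.eval, h2, a2] at hb''
    refine Or.inr ⟨h3, h4, fun i hi hne => ?_⟩
    rcases Nat.lt_succ_iff_lt_or_eq.1 hi with hi | rfl
    exacts [h i hi hne, not_lt.1 hb'']

end Programs
end RealRAM

/-! ### Invariant and running time of the sweep -/

namespace RealRAM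
open Finset
section Programs
variable {W n : ℕ} {px py : ℕ → ℝ} {w : ℕ → ℕ → ℝ} {wE : ℕ → ℕ → RExpr}

theorem CorrectOn.weight_eq {κ : ℝ} {s : State}
    (h : CorrectOn n px py w κ (fun _ _ _ => True) s) :
    s.rvar 1 = blockedWeight n w (Blocks px py κ) := by
  obtain ⟨β, hβ, hc⟩ := h
  rw [hβ.weight]
  unfold blockedWeight
  refine Finset.sum_congr rfl fun p hp => ?_
  simp only [mem_product, mem_range] at hp
  have : (∃ m < n, β p.1 p.2 m) ↔ ∃ m < n, Blocks px py κ p.1 p.2 m :=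
    exists_congr fun m => and_congr_right fun hm => hc _ hp.1 _ hp.2 _ hm trivial
  by_cases hb : ∃ m < n, β p.1 p.2 m
  · rw [if_pos hb, if_pos (this.1 hb)]
  · rw [if_neg hb, if_neg (mt this.2 hb)]

theorem IsRowMin.le {κ : ℝ} {i k c : ℕ} (h : IsRowMin n px py κ i k c) : c ≤ n := by
  rcases h with h | h <;> omega

open Classical in
theorem writeGraph_runs (hW : (n + 1) ^ 3 ≤ W) {s : State} (hin : HasInput n px py s) {κ : ℝ}
    (h : CorrectOn n px py w κ (fun _ _ _ => True) s) :
    Runs W writeGraph s (writeGraph.time n) (fun s' => ∀ i < n, ∀ j < n,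
      s'.narr 0 (i * n + j) = if i ≠ j ∧ ∀ m < n, ¬ Blocks px py κ i j m then 1 else 0) := by
  have hW' := succ_le_of_pow_le hW
  obtain ⟨β, hβ, hc⟩ := h
  have hcount : ∀ i < n, ∀ j < n,
      s.narr 1 (i * n + j) ≤ n ∧ (s.narr 1 (i * n + j) = 0 ↔ ∀ m < n, ¬ Blocks px py κ i j m) := by
    intro i hi j hj
    rw [hβ.count i hi j hj]
    refine ⟨(Finset.card_filter_le _ _).trans (by simp), ?_⟩
    rw [Finset.card_eq_zero, Finset.filter_eq_empty_iff]
    simp only [mem_range]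
    exact forall₂_congr fun m hm => not_congr (hc i hi j hj m hm trivial)
  set A : ℕ → ℕ → ℕ := fun i j => if i ≠ j ∧ ∀ m < n, ¬ Blocks px py κ i j m then 1 else 0 with hA
  refine (Runs.forN (I := fun a s' => ∀ i < n, ∀ j < n, i < a → s'.narr 0 (i * n + j) = A i j)
    rfl rfl rfl hin.size hW' (fun k s v h => h) (by simp) ?_).imp
    fun s' _ h i hi j hj => h i hi j hj hi
  intro a s1 ha h1 F1 C1
  have in1 : HasInput n px py s1 := hin.frame F1 rfl rfl rfl
  refine (Runs.forN (I := fun b s' => ∀ i < n, ∀ j < n, i < a ∨ (i = a ∧ j < b) →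
    s'.narr 0 (i * n + j) = A i j) rfl rfl rfl in1.size hW' (fun k s v h => h) ?_ ?_).imp
    fun s' _ h i hi j hj hij => h i hi j hj (by omega)
  · intro i hi j hj hij
    exact C1 i hi j hj (by omega)
  intro b s2 hb h2 F2 C2
  have in2 : HasInput n px py s2 := in1.frame F2 rfl rfl rfl
  have e1 : s2.nvar 1 = a := by rw [F2.nvar 1 rfl, h1]
  have a2 : s2.narr 1 = s.narr 1 := (F2.narr 1 rfl).trans (F1.narr 1 rfl)
  have fidx : (idxE 1 2).Fits W s2 :=
    (idx3E_fits (z := 1) hW in2.size (by omega) (by omega) (by omega)).1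
  have eidx : (idxE 1 2).eval s2 = a * n + b := by rw [idxE_eval in2.size, e1, h2]
  obtain ⟨g1, g2⟩ := hcount a ha b hb
  have upd : ∀ v, v = A a b → ∀ i < n, ∀ j < n, i < a ∨ (i = a ∧ j < b + 1) →
      Function.update (s2.narr 0) (a * n + b) v (i * n + j) = A i j := by
    rintro v rfl i hi j hj hij
    by_cases hh : i = a ∧ j = b
    · obtain ⟨rfl, rfl⟩ := hh
      simp
    · rw [Function.update_of_ne (fun h => hh (index_inj hj hb h)), C2 i hi j hj (by omega)]
  refine Runs.cond ?_ (fun hh => Runs.nput fidx ?_ ?_) (fun hh => Runs.nput fidx ?_ ?_)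
  · simp only [BExpr.Fits, NExpr.Fits, fidx, eidx, a2, true_and]
    omega
  · simp only [NExpr.Fits]; omega
  · simp only [BExpr.Holds, NExpr.eval, eidx, e1, h2, a2, g2] at hh
    simp only [NExpr.eval, eidx, Function.update_self]
    exact upd 1 (by rw [hA]; exact (if_pos hh).symm)
  · simp only [NExpr.Fits]; omega
  · simp only [BExpr.Holds, NExpr.eval, eidx, e1, h2, a2, g2] at hh
    simp only [NExpr.eval, eidx, Function.update_self]
    exact upd 0 (by rw [hA]; exact (if_neg hh).symm)

/-- What the sweep needs to know about the points. -/
structure SweepFacts (n : ℕ) (px py : ℕ → ℝ) : Prop where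
  key_inj : ∀ i j i' j', i < j → j < n → i' < j' → j' < n →
    pairKey px py i j = pairKey px py i' j' → i = i' ∧ j = j'
  change : ∀ κ κ' i j m, i < n → j < n → m < n → 0 ≤ κ → κ ≤ κ' →
    (Blocks px py κ i j m ↔ Blocks px py κ' i j m) ∨
      ∃ p q, p < q ∧ q < n ∧ κ ≤ pairKey px py p q ∧ pairKey px py p q ≤ κ' ∧ Touches p q i j m

/-- Loop invariant of the sweep; at most `k` rounds remain. -/
structure SweepInv (n : ℕ) (px py : ℕ → ℝ) (w : ℕ → ℕ → ℝ) (k : ℕ) (s : State) : Prop where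
  input : HasInput n px py s
  table : CorrectOn n px py w (max (s.rvar 0) 0) (fun _ _ _ => True) s
  rows : ∀ i < n, IsRowMin n px py (s.rvar 0) i n (s.narr 3 i)
  pick : IsPick n px py (s.narr 3) n (s.nvar 5)
  current : ∀ i j, i < j → j < n → pairKey px py i j = s.rvar 0 → i = s.nvar 6 ∧ j = s.nvar 7
  current_lt : 0 < n → s.nvar 6 < n ∧ s.nvar 7 < n
  best_nonneg : 0 ≤ s.rvar 3
  best_eq : s.rvar 2 = blockedWeight n w (Blocks px py (s.rvar 3))
  best_zero : blockedWeight n w (Blocks px py 0) ≤ s.rvar 2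
  best_ge : ∀ i j, i < j → j < n → pairKey px py i j ≤ s.rvar 0 →
    blockedWeight n w (Blocks px py (pairKey px py i j)) ≤ s.rvar 2
  rounds : #{p ∈ range n ×ˢ range n | p.1 < p.2 ∧ s.rvar 0 < pairKey px py p.1 p.2} ≤ k

theorem advance_runs (hW : n + 1 ≤ W) {s : State} (hin : HasInput n px py s)
    (h6 : s.nvar 6 ≤ n) (h7 : s.nvar 7 ≤ n) (h5 : s.nvar 5 < n) (hc : s.narr 3 (s.nvar 5) < n) :
    Runs W advance s (advance.time n) (fun s' => s'.nvar 8 = s.nvar 6 ∧ s'.nvar 9 = s.nvar 7 ∧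
      s'.nvar 6 = s.nvar 5 ∧ s'.nvar 7 = s.narr 3 (s.nvar 5) ∧
      s'.rvar 0 = pairKey px py (s.nvar 5) (s.narr 3 (s.nvar 5))) := by
  refine Runs.seq (R := fun s' => s'.nvar = Function.update s.nvar 8 (s.nvar 6))
    (Runs.nset (by simp only [NExpr.Fits]; omega) rfl) fun s1 F1 h1 => ?_
  have a1 : s1.narr = s.narr := funext fun v => F1.narr v rfl
  refine Runs.seq (R := fun s' => s'.nvar = Function.update s1.nvar 9 (s.nvar 7))
    (Runs.nset (by simp only [NExpr.Fits, h1]; simp; omega) (by simp [NExpr.eval, h1]))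
    fun s2 F2 h2 => ?_
  have a2 : s2.narr = s.narr := (funext fun v => F2.narr v rfl).trans a1
  refine Runs.seq (R := fun s' => s'.nvar = Function.update s2.nvar 6 (s.nvar 5))
    (Runs.nset (by simp only [NExpr.Fits, h1, h2]; simp; omega) (by simp [NExpr.eval, h1, h2]))
    fun s3 F3 h3 => ?_
  have a3 : s3.narr = s.narr := (funext fun v => F3.narr v rfl).trans a2
  refine Runs.seq (R := fun s' => s'.nvar = Function.update s3.nvar 7 (s.narr 3 (s.nvar 5)))
    (Runs.nset (by simp only [NExpr.Fits, NExpr.eval, h1, h2, h3, a3]; simp; omega)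
      (by simp [NExpr.eval, h3, a3])) fun s4 F4 h4 => ?_
  have in4 : HasInput n px py s4 := (((hin.frame F1 rfl rfl rfl).frame F2 rfl rfl rfl).frame F3
    rfl rfl rfl).frame F4 rfl rfl rfl
  refine Runs.rset (keyE_fits ?_ ?_ (by omega)) ?_
  · simp only [NExpr.Fits, h3, h4]; simp; omega
  · simp only [NExpr.Fits, h3, h4]; simp; omega
  · simp [keyE_eval in4, NExpr.eval, h1, h2, h3, h4]

theorem recordBest_runs {s : State} : Runs W recordBest s (recordBest.time n) (fun s' =>
    (s.rvar 2 < s.rvar 1 ∧ s'.rvar 2 = s.rvar 1 ∧ s'.rvar 3 = s.rvar 0) ∨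
    (s.rvar 1 ≤ s.rvar 2 ∧ s'.rvar 2 = s.rvar 2 ∧ s'.rvar 3 = s.rvar 3)) := by
  refine Runs.cond ⟨trivial, trivial⟩ (fun hb => ?_)
    (fun hb => Runs.skip (Or.inr ⟨not_lt.1 hb, rfl, rfl⟩))
  refine Runs.seq (R := fun s' => s'.rvar = Function.update s.rvar 2 (s.rvar 1))
    (Runs.rset trivial rfl) fun s1 F1 h1 => Runs.rset trivial (Or.inl ⟨hb, ?_, ?_⟩)
  · simp [h1]
  · simp [RExpr.eval, h1]

/-- From `κ` to the next key `κ'`, a triple changes only if it touches a pair whose key lies in the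
closed interval between them: the old pair, which leaves its alignment, or the new one, which enters
it. Distinct keys make each of these a single pair. For the same reason all rows except `r` keep
their candidates, and rescanning `r` suffices. -/
theorem sweepStep_runs (hw : ComputesWeight W px py w wE) (hW : (n + 1) ^ 3 ≤ W)
    (hP : SweepFacts n px py) {k : ℕ} {s : State} (h : SweepInv n px py w k s)
    (hr : s.nvar 5 < n) :
    ∃ l, k = l + 1 ∧ Runs W (sweepStep wE) s ((sweepStep wE).time n) (SweepInv n px py w l) := by
  have hW' := succ_le_of_pow_le hW
  have hn : 0 < n := by omega
  obtain ⟨ha, hb⟩ := h.current_lt hn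
  obtain ⟨r, hr5⟩ : ∃ r, s.nvar 5 = r := ⟨_, rfl⟩
  obtain ⟨c, hc3⟩ : ∃ c, s.narr 3 r = c := ⟨_, rfl⟩
  obtain ⟨κ, hκ⟩ : ∃ κ, s.rvar 0 = κ := ⟨_, rfl⟩
  obtain ⟨a, ha6⟩ : ∃ a, s.nvar 6 = a := ⟨_, rfl⟩
  obtain ⟨b, hb7⟩ : ∃ b, s.nvar 7 = b := ⟨_, rfl⟩
  have hrows := h.rows
  have hpick := h.pick
  have hcur := h.current
  have hbest := h.best_ge
  have hrounds := h.rounds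
  have htable := h.table
  rw [hr5] at hr hpick
  rw [ha6] at ha
  rw [hb7] at hb
  simp only [hκ, ha6, hb7] at hrows hcur hbest hrounds htable
  obtain ⟨hrn, hcn, hmin⟩ := hpick.resolve_left (fun hh => hr.ne hh.1)
  rw [hc3] at hcn
  simp only [hc3] at hmin
  have hrow := hrows r hr
  rw [hc3] at hrow
  obtain ⟨hc, hrc, hκc, -⟩ := hrow.resolve_left (fun hh => hcn hh.1)
  obtain ⟨κ', hκ'⟩ : ∃ κ', pairKey px py r c = κ' := ⟨_, rfl⟩
  simp only [hκ'] at hmin hκc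
  have hκ'0 : 0 ≤ κ' := hκ' ▸ dirKey_nonneg _ _
  have hnext : ∀ i j, i < j → j < n → κ < pairKey px py i j → κ' ≤ pairKey px py i j := by
    intro i j hij hj hlt
    rcases hrows i (hij.trans hj) with ⟨-, hh⟩ | ⟨h1, -, -, hh⟩
    · exact absurd hlt (not_lt.2 (hh j hj hij))
    · exact (hmin i (hij.trans hj) h1.ne).trans (hh j hj hij hlt)
  have hkey : ∀ i j, i < j → j < n → pairKey px py i j ≤ κ' →
      pairKey px py i j ≤ κ ∨ (i = r ∧ j = c) := by
    intro i j hij hj hle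
    rcases le_or_gt (pairKey px py i j) κ with hh | hh
    · exact Or.inl hh
    · exact Or.inr (hP.key_inj i j r c hij hj hrc hc
        ((le_antisymm hle (hnext i j hij hj hh)).trans hκ'.symm))
  -- The pair `r, c` stops being pending, so the bound on the remaining rounds drops.
  have hcard : #{p ∈ range n ×ˢ range n | p.1 < p.2 ∧ κ' < pairKey px py p.1 p.2} <
      #{p ∈ range n ×ˢ range n | p.1 < p.2 ∧ κ < pairKey px py p.1 p.2} := by
    refine Finset.card_lt_card ((Finset.ssubset_iff_of_subset ?_).2 ⟨(r, c), ?_, ?_⟩)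
    · intro p
      simp only [mem_filter]
      exact fun hp => ⟨hp.1, hp.2.1, hκc.trans hp.2.2⟩
    · simp [hr, hc, hrc, hκ', hκc]
    · simp [hκ']
  refine ⟨k - 1, by omega, ?_⟩
  refine Runs.seq (advance_runs hW' h.input (by omega) (by omega) (by omega)
    (by rw [hr5]; omega)) fun s1 F1 h1 => ?_
  rw [hr5, ha6, hb7, hc3, hκ'] at h1
  obtain ⟨g8, g9, g6, g7, g0⟩ := h1
  have in1 : HasInput n px py s1 := h.input.frame F1 rfl rfl rfl
  -- The table of the old slope is reread as a table for `κ'`, trusted only where the two slopes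
  -- agree.
  have t1 : CorrectOn n px py w (s1.rvar 0)
      (fun i j m => Blocks px py (max κ 0) i j m ↔ Blocks px py κ' i j m) s1 := by
    obtain ⟨β, hβ, hcor⟩ := htable
    refine CorrectOn.congr (s := s) ⟨β, hβ, fun i hi j hj m hm hh => ?_⟩
      (F1.narr 1 rfl) (F1.narr 2 rfl) (F1.rvar 1 rfl)
    rw [hcor i hi j hj m hm trivial, g0]
    exact hh
  refine Runs.seq (updateTouching_runs hw hW in1 rfl rfl g8 g9 (by omega) (by omega) t1)
    fun s2 F2 t2 => ?_
  have in2 : HasInput n px py s2 := in1.frame F2 rfl rfl rfl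
  have e2 : s2.rvar 0 = s1.rvar 0 := F2.rvar 0 rfl
  rw [← e2] at t2
  refine Runs.seq (updateTouching_runs hw hW in2 rfl rfl ((F2.nvar 6 rfl).trans g6)
    ((F2.nvar 7 rfl).trans g7) (by omega) (by omega) t2) fun s3 F3 t3 => ?_
  have in3 : HasInput n px py s3 := in2.frame F3 rfl rfl rfl
  have e3 : s3.rvar 0 = κ' := by rw [F3.rvar 0 rfl, e2, g0]
  have full3 : CorrectOn n px py w κ' (fun _ _ _ => True) s3 := by
    rw [e2, g0] at t3
    refine t3.mono fun i hi j hj m hm _ => ?_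
    rcases hP.change (max κ 0) κ' i j m hi hj hm (le_max_right _ _) (max_le hκc.le hκ'0) with
      hh | ⟨p, q, hpq, hq, h1, h2, hT⟩
    · exact Or.inl (Or.inl hh)
    · rcases hkey p q hpq hq h2 with h2 | ⟨rfl, rfl⟩
      · obtain ⟨rfl, rfl⟩ := hcur p q hpq hq (le_antisymm h2 ((le_max_left _ _).trans h1))
        exact Or.inl (Or.inr hT)
      · exact Or.inr hT
  have w3 := full3.weight_eq
  have v2 : s3.rvar 2 = s.rvar 2 := by rw [F3.rvar 2 rfl, F2.rvar 2 rfl, F1.rvar 2 rfl]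
  have v3 : s3.rvar 3 = s.rvar 3 := by rw [F3.rvar 3 rfl, F2.rvar 3 rfl, F1.rvar 3 rfl]
  refine Runs.seq recordBest_runs fun s4 F4 h4 => ?_
  rw [w3, v2, v3, e3] at h4
  have in4 : HasInput n px py s4 := in3.frame F4 rfl rfl rfl
  have e4 : s4.rvar 0 = κ' := by rw [F4.rvar 0 rfl, e3]
  have g64 : s4.nvar 6 = r := by rw [F4.nvar 6 rfl, F3.nvar 6 rfl, F2.nvar 6 rfl, g6]
  have g74 : s4.nvar 7 = c := by rw [F4.nvar 7 rfl, F3.nvar 7 rfl, F2.nvar 7 rfl, g7]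
  have a4 : s4.narr 3 = s.narr 3 := by rw [F4.narr 3 rfl, F3.narr 3 rfl, F2.narr 3 rfl, F1.narr 3 rfl]
  refine Runs.seq (scanRow_runs hW' in4 rfl rfl g64 hr) fun s5 F5 h5 => ?_
  rw [e4, a4] at h5
  obtain ⟨c', hc', a5⟩ := h5
  have in5 : HasInput n px py s5 := in4.frame F5 rfl rfl rfl
  have rows5 : ∀ i < n, IsRowMin n px py κ' i n (s5.narr 3 i) := by
    intro i hi
    rw [a5]
    by_cases hir : i = r
    · subst hir
      simpa using hc'
    · rw [Function.update_of_ne hir]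
      rcases hrows i hi with ⟨h1, hh⟩ | ⟨h1, h2, h3, hh⟩
      · exact Or.inl ⟨h1, fun j hj hij => (hh j hj hij).trans hκc.le⟩
      -- A candidate of another row has a key different from `κ'`, hence strictly above it, and it
      -- stays minimal.
      · refine Or.inr ⟨h1, h2, lt_of_le_of_ne (hnext _ _ h2 h1 h3) fun heq => ?_,
          fun j hj hij hlt => hh j hj hij (hκc.trans hlt)⟩
        exact hir (hP.key_inj _ _ r c h2 h1 hrc hc (heq.symm.trans hκ'.symm)).1
  refine (pickRow_runs hW' in5 fun i hi => (rows5 i hi).le).imp fun s6 F6 h6 => ?_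
  have e6 : s6.rvar 0 = κ' := by rw [F6.rvar 0 rfl, F5.rvar 0 rfl, e4]
  have a6 : s6.narr 3 = s5.narr 3 := F6.narr 3 rfl
  have v26 : s6.rvar 2 = s4.rvar 2 := by rw [F6.rvar 2 rfl, F5.rvar 2 rfl]
  have v36 : s6.rvar 3 = s4.rvar 3 := by rw [F6.rvar 3 rfl, F5.rvar 3 rfl]
  have g66 : s6.nvar 6 = r := by rw [F6.nvar 6 rfl, F5.nvar 6 rfl, g64]
  have g76 : s6.nvar 7 = c := by rw [F6.nvar 7 rfl, F5.nvar 7 rfl, g74]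
  have mono : s.rvar 2 ≤ s4.rvar 2 ∧ blockedWeight n w (Blocks px py κ') ≤ s4.rvar 2 := by
    rcases h4 with ⟨h1, h2, -⟩ | ⟨h1, h2, -⟩ <;> rw [h2]
    exacts [⟨h1.le, le_rfl⟩, ⟨le_rfl, h1⟩]
  refine ⟨in5.frame F6 rfl rfl rfl, ?_, ?_, ?_, ?_, ?_, ?_, ?_, ?_, ?_, ?_⟩
  · rw [e6, max_eq_left hκ'0]
    exact full3.congr (by rw [F6.narr 1 rfl, F5.narr 1 rfl, F4.narr 1 rfl])
      (by rw [F6.narr 2 rfl, F5.narr 2 rfl, F4.narr 2 rfl])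
      (by rw [F6.rvar 1 rfl, F5.rvar 1 rfl, F4.rvar 1 rfl])
  · rw [e6, a6]; exact rows5
  · rw [a6]; exact h6
  · rw [e6, g66, g76]
    intro i j hij hj heq
    exact hP.key_inj i j r c hij hj hrc hc (heq.trans hκ'.symm)
  · rw [g66, g76]
    exact fun _ => ⟨hr, hc⟩
  · rw [v36]
    rcases h4 with ⟨-, -, h1⟩ | ⟨-, -, h1⟩ <;> rw [h1]
    exacts [hκ'0, h.best_nonneg]
  · rw [v26, v36]
    rcases h4 with ⟨-, h1, h2⟩ | ⟨-, h1, h2⟩ <;> rw [h1, h2]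
    exact h.best_eq
  · rw [v26]
    exact h.best_zero.trans mono.1
  · rw [v26, e6]
    intro i j hij hj hle
    rcases hkey i j hij hj hle with hh | ⟨rfl, rfl⟩
    · exact (hbest i j hij hj hh).trans mono.1
    · rw [hκ']
      exact mono.2
  · rw [e6]
    omega

/-- The memory at the start: apart from the input, everything is zero. -/
structure IsInitial (n : ℕ) (px py : ℕ → ℝ) (s : State) : Prop where
  input : HasInput n px py s
  nvar : ∀ x, x ≠ 0 → s.nvar x = 0
  rvar : ∀ x, s.rvar x = 0
  narr : ∀ a i, s.narr a i = 0

theorem sweepInit_runs (hw : ComputesWeight W px py w wE) (hW : (n + 1) ^ 3 ≤ W) {s : State}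
    (h : IsInitial n px py s) :
    Runs W (sweepInit wE) s ((sweepInit wE).time n) (SweepInv n px py w (n * n)) := by
  have hW' := succ_le_of_pow_le hW
  have t0 : CorrectOn n px py w (s.rvar 0) (fun _ _ _ => False) s := by
    refine ⟨fun _ _ _ => False, ⟨?_, ?_, ?_⟩, by simp⟩ <;> simp [h.narr, h.rvar, blockedWeight]
  refine Runs.seq (updateAll_runs hw hW h.input t0) fun s1 F1 t1 => ?_
  rw [h.rvar] at t1
  have in1 : HasInput n px py s1 := h.input.frame F1 rfl rfl rfl
  refine Runs.seq (R := fun s' => s'.rvar 2 = s1.rvar 1) (Runs.rset trivial (by simp [RExpr.eval]))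
    fun s2 F2 h2 => ?_
  have in2 : HasInput n px py s2 := in1.frame F2 rfl rfl rfl
  -- Starting below all keys leaves a possible key 0 pending. The table belongs to slope 0 at this
  -- point, which is why the invariant speaks of the maximum of the slope and 0.
  refine Runs.seq (R := fun s' => s'.rvar 0 = -1) (Runs.rset ?_ (by simp [RExpr.eval, NExpr.eval]))
    fun s3 F3 h3 => ?_
  · simp only [RExpr.Fits, NExpr.Fits]; omega
  have in3 : HasInput n px py s3 := in2.frame F3 rfl rfl rfl
  refine Runs.seq (Runs.forN (I := fun k s' => ∀ i < k, IsRowMin n px py (-1) i n (s'.narr 3 i))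
    rfl rfl rfl in3.size hW' (fun k s v h => h) (by simp) ?_) fun s4 F4 h4 => ?_
  · intro i s' hi hi1 F hI
    refine (scanRow_runs hW' (in3.frame F rfl rfl rfl) rfl rfl hi1 hi).imp ?_
    rintro s'' - ⟨c, hc, ha⟩ j hj
    rw [F.rvar 0 rfl, h3] at hc
    rw [ha]
    by_cases hji : j = i
    · subst hji
      simpa using hc
    · rw [Function.update_of_ne hji]
      exact hI j (by omega)
  have in4 : HasInput n px py s4 := in3.frame F4 rfl rfl rfl
  refine (pickRow_runs hW' in4 fun i hi => (h4 i hi).le).imp fun s5 F5 h5 => ?_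
  have e5 : s5.rvar 0 = -1 := by rw [F5.rvar 0 rfl, F4.rvar 0 rfl, h3]
  have a5 : s5.narr 3 = s4.narr 3 := F5.narr 3 rfl
  have v1 : s5.rvar 1 = s1.rvar 1 := by
    rw [F5.rvar 1 rfl, F4.rvar 1 rfl, F3.rvar 1 rfl, F2.rvar 1 rfl]
  have v2 : s5.rvar 2 = blockedWeight n w (Blocks px py 0) := by
    rw [F5.rvar 2 rfl, F4.rvar 2 rfl, F3.rvar 2 rfl, h2, t1.weight_eq]
  have v3 : s5.rvar 3 = 0 := by
    rw [F5.rvar 3 rfl, F4.rvar 3 rfl, F3.rvar 3 rfl, F2.rvar 3 rfl, F1.rvar 3 rfl, h.rvar]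
  have neg (i j : ℕ) : -1 < pairKey px py i j := by
    have : 0 ≤ pairKey px py i j := dirKey_nonneg _ _
    linarith
  refine ⟨in4.frame F5 rfl rfl rfl, ?_, ?_, ?_, ?_, ?_, ?_, ?_, ?_, ?_, ?_⟩
  · rw [e5, max_eq_right (by norm_num)]
    exact t1.congr (by rw [F5.narr 1 rfl, F4.narr 1 rfl, F3.narr 1 rfl, F2.narr 1 rfl])
      (by rw [F5.narr 2 rfl, F4.narr 2 rfl, F3.narr 2 rfl, F2.narr 2 rfl]) v1
  · rw [e5, a5]; exact h4
  · rw [a5]; exact h5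
  · rw [e5]
    intro i j _ _ heq
    exact absurd heq (neg i j).ne'
  -- The initial current pair is the dummy `0, 0`. It only has to be a valid index, because no key
  -- equals `-1`.
  · rw [F5.nvar 6 rfl, F4.nvar 6 rfl, F3.nvar 6 rfl, F2.nvar 6 rfl, F1.nvar 6 rfl,
      F5.nvar 7 rfl, F4.nvar 7 rfl, F3.nvar 7 rfl, F2.nvar 7 rfl, F1.nvar 7 rfl,
      h.nvar 6 (by norm_num), h.nvar 7 (by norm_num)]
    exact fun hn => ⟨hn, hn⟩
  · rw [v3]
  · rw [v2, v3]
  · rw [v2]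
  · rw [e5]
    intro i j _ _ hle
    exact absurd hle (not_le.2 (neg i j))
  · exact (Finset.card_filter_le _ _).trans (by simp)

/-- The slope `κ` blocks the largest weight among all critical slopes. -/
def IsOptimalSlope (n : ℕ) (px py : ℕ → ℝ) (w : ℕ → ℕ → ℝ) (κ : ℝ) : Prop :=
  0 ≤ κ ∧ blockedWeight n w (Blocks px py 0) ≤ blockedWeight n w (Blocks px py κ) ∧
  ∀ i j, i < j → j < n → blockedWeight n w (Blocks px py (pairKey px py i j)) ≤
    blockedWeight n w (Blocks px py κ)

/-- The sentinel in variable `5` means that no row has a pending key, so every key has been compared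
with the best value. -/
theorem SweepInv.isOptimalSlope {k : ℕ} {s : State} (h : SweepInv n px py w k s)
    (hr : ¬ s.nvar 5 < n) : IsOptimalSlope n px py w (s.rvar 3) := by
  refine ⟨h.best_nonneg, h.best_eq ▸ h.best_zero, fun i j hij hj => h.best_eq ▸ ?_⟩
  refine h.best_ge i j hij hj ?_
  rcases h.pick with ⟨-, hh⟩ | ⟨hlt, -⟩
  · have hi := hij.trans hj
    rcases h.rows i hi with ⟨-, h1⟩ | ⟨h1, -⟩
    · exact h1 j hj hij
    · exact absurd (hh i hi) h1.ne
  · exact absurd hlt hr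

/-- Time bound for the complete program. -/
def sweepTime (wE : ℕ → ℕ → RExpr) (n : ℕ) : ℕ :=
  (sweepInit wE).time n + (n * n * ((BExpr.nlt (.var 5) (.var 0)).cost + 1 + (sweepStep wE).time n)
    + ((BExpr.nlt (.var 5) (.var 0)).cost + 1) + (sweepFinish wE).time n)

open Classical in
-- Copying a graph at every improvement would cost quadratic time per round. The sweep keeps only
-- the best slope, and one final cubic pass rebuilds its table.
theorem sweep_runs (hw : ComputesWeight W px py w wE) (hW : (n + 1) ^ 3 ≤ W)
    (hP : SweepFacts n px py) {s : State} (h : IsInitial n px py s) :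
    Runs W (sweep wE) s (sweepTime wE n) (fun s' => ∃ κ, IsOptimalSlope n px py w κ ∧
      ∀ i < n, ∀ j < n, s'.narr 0 (i * n + j) =
        if i ≠ j ∧ ∀ m < n, ¬ Blocks px py κ i j m then 1 else 0) := by
  have hW' := succ_le_of_pow_le hW
  refine Runs.seq' (sweepInit_runs hw hW h) fun s1 F1 h1 => ?_
  refine Runs.seq' (Runs.loop (Q := fun s' => ∃ k, SweepInv n px py w k s' ∧ ¬ s'.nvar 5 < n)
    (SweepInv n px py w) s1 ?_ ?_ ?_ _ s1 (Frame.refl _ _) h1) ?_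
  · intro k s' hs'
    simp only [BExpr.Fits, NExpr.Fits, hs'.input.size]
    rcases hs'.pick with ⟨h5, -⟩ | ⟨h5, -⟩ <;> omega
  · intro k s' hs' hb
    simp only [BExpr.Holds, NExpr.eval, hs'.input.size] at hb
    exact ⟨k, hs', hb⟩
  · intro k s' hs' hb _
    simp only [BExpr.Holds, NExpr.eval, hs'.input.size] at hb
    exact sweepStep_runs hw hW hP hs' hb
  rintro s2 - ⟨k, h2, hr⟩
  have hopt := h2.isOptimalSlope hr
  refine Runs.seq (R := fun s' => s'.rvar 0 = s2.rvar 3) (Runs.rset trivial (by simp [RExpr.eval]))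
    fun s3 F3 h3 => ?_
  have in3 : HasInput n px py s3 := h2.input.frame F3 rfl rfl rfl
  have t3 : CorrectOn n px py w (s3.rvar 0) (fun _ _ _ => False) s3 := by
    obtain ⟨β, hβ, -⟩ := h2.table
    exact CorrectOn.congr (s := s2) ⟨β, hβ, by simp⟩ (F3.narr 1 rfl) (F3.narr 2 rfl) (F3.rvar 1 rfl)
  refine Runs.seq (updateAll_runs hw hW in3 t3) fun s4 F4 t4 => ?_
  refine (writeGraph_runs hW (in3.frame F4 rfl rfl rfl) t4).imp fun s5 _ h5 => ⟨_, hopt, ?_⟩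
  rw [h3] at h5
  exact h5

/-- `Cmd.time` allows `n` rounds per loop, but the main loop needs `n * n`, so its bound is
assembled separately: quadratically many rounds of depth 1, between two programs of depth 3. -/
theorem sweepTime_le (wE : ℕ → ℕ → RExpr) :
    ∃ K, ∀ n, sweepTime wE n ≤ K * (n ^ 3 + 1) := by
  have h1 (n : ℕ) := (sweepInit wE).time_le n
  have h2 (n : ℕ) := (sweepStep wE).time_le n
  have h3 (n : ℕ) := (sweepFinish wE).time_le n
  rw [show (sweepInit wE).depth = 3 from rfl] at h1
  rw [show (sweepStep wE).depth = 1 from rfl] at h2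
  rw [show (sweepFinish wE).depth = 3 from rfl] at h3
  generalize (sweepInit wE).factor = A at h1
  generalize (sweepStep wE).factor = B at h2
  generalize (sweepFinish wE).factor = C at h3
  generalize hD : (BExpr.nlt (.var 5) (.var 0)).cost + 1 = D
  refine ⟨(A + B + C + 2 * D) * 8, fun n => ?_⟩
  -- For positive `n` one has `n + 1 ≤ 2 * n`, whose cube gives the factor 8.
  have h8 : (n + 1) ^ 3 ≤ 8 * (n ^ 3 + 1) := by
    rcases Nat.eq_zero_or_pos n with rfl | hn
    · norm_num
    · calc (n + 1) ^ 3 ≤ (2 * n) ^ 3 := Nat.pow_le_pow_left (by omega) 3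
        _ ≤ 8 * (n ^ 3 + 1) := by ring_nf; omega
  have hone : 1 ≤ (n + 1) ^ 3 := Nat.one_le_pow _ _ (Nat.succ_pos n)
  have hsq : n * n * (n + 1) ≤ (n + 1) ^ 3 := by
    calc n * n * (n + 1) ≤ (n + 1) * (n + 1) * (n + 1) := by gcongr <;> omega
      _ = _ := by ring
  have hsq' : n * n ≤ (n + 1) ^ 3 := le_trans (Nat.le_mul_of_pos_right _ (Nat.succ_pos n)) hsq
  calc sweepTime wE n
      ≤ A * (n + 1) ^ 3 + (n * n * (D + B * (n + 1) ^ 1) + D + C * (n + 1) ^ 3) := by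
        unfold sweepTime
        rw [hD]
        gcongr
        exacts [h1 n, h2 n, h3 n]
    _ = A * (n + 1) ^ 3 + (D * (n * n) + B * (n * n * (n + 1)) + D * 1 + C * (n + 1) ^ 3) := by ring
    _ ≤ A * (n + 1) ^ 3 + (D * (n + 1) ^ 3 + B * (n + 1) ^ 3 + D * (n + 1) ^ 3
          + C * (n + 1) ^ 3) := by gcongr
    _ = (A + B + C + 2 * D) * (n + 1) ^ 3 := by ring
    _ ≤ (A + B + C + 2 * D) * (8 * (n ^ 3 + 1)) := Nat.mul_le_mul_left _ h8
    _ = _ := by ring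

end Programs
end RealRAM

/-! ### Empty rectangles and monotone paths -/

/-- Two indices are adjacent if the closed rectangle spanned by their positions `(f, g)` contains
no further index. -/
def emptyRectGraph {ι : Type*} (f g : ι → ℝ) : SimpleGraph ι where
  Adj i j := i ≠ j ∧ ∀ m, m ≠ i → m ≠ j →
    ¬ (0 ≤ (f m - f i) * (f j - f m) ∧ 0 ≤ (g m - g i) * (g j - g m))
  symm := ⟨fun i j ⟨h, h'⟩ => ⟨h.symm, fun m hj hi hm => h' m hi hj
    ⟨by linarith [hm.1, mul_comm (f m - f i) (f j - f m)],
      by linarith [hm.2, mul_comm (g m - g i) (g j - g m)]⟩⟩⟩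
  loopless := ⟨fun i h => h.1 rfl⟩

/-- Each condition is a product of two differences of one coordinate, so scaling multiplies it by a
positive square. Reflections and the normalization of axes thereby become harmless. -/
theorem emptyRectGraph_smul {ι : Type*} (f g : ι → ℝ) {a b : ℝ} (ha : a ≠ 0) (hb : b ≠ 0) :
    emptyRectGraph (fun i => a * f i) (fun i => b * g i) = emptyRectGraph f g := by
  ext i j
  have scale (c x y : ℝ) (hc : c ≠ 0) : 0 ≤ c * c * (x * y) ↔ 0 ≤ x * y :=
    mul_nonneg_iff_of_pos_left (mul_self_pos.2 hc)
  have e (c : ℝ) (h : ι → ℝ) (m : ι) : (c * h m - c * h i) * (c * h j - c * h m)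
      = c * c * ((h m - h i) * (h j - h m)) := by ring
  simp only [emptyRectGraph, e, scale _ _ _ ha, scale _ _ _ hb]

theorem emptyRectGraph_swap {ι : Type*} (f g : ι → ℝ) :
    emptyRectGraph f g = emptyRectGraph g f := by
  ext i j
  simp only [emptyRectGraph, and_comm]

/-- Induction on the number of points in the rectangle. An inner point `m` splits it into two
rectangles with fewer points, one missing `j` and the other missing `i`, because distinct indices
have distinct positions. Ties in a single coordinate are allowed. -/
theorem emptyRectGraph_exists_walk {ι : Type*} [Fintype ι] {f g : ι → ℝ}
    (hinj : ∀ i j, f i = f j → g i = g j → i = j) (i j : ι) (hf : f i ≤ f j) (hg : g i ≤ g j) :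
    ∃ w : (emptyRectGraph f g).Walk i j, w.support.Pairwise (fun a b => f a ≤ f b ∧ g a ≤ g b) ∧
      ∀ m ∈ w.support, (f i ≤ f m ∧ g i ≤ g m) ∧ f m ≤ f j ∧ g m ≤ g j := by
  classical
  induction hN : (Finset.univ.filter fun m => (f i ≤ f m ∧ g i ≤ g m) ∧ f m ≤ f j ∧ g m ≤ g j).card
    using Nat.strong_induction_on generalizing i j with
  | _ N ih =>
    by_cases hij : i = j
    · subst hij
      exact ⟨.nil, by simp, by simp⟩
    by_cases hm : ∃ m, m ≠ i ∧ m ≠ j ∧ (f i ≤ f m ∧ g i ≤ g m) ∧ f m ≤ f j ∧ g m ≤ g j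
    · obtain ⟨m, hmi, hmj, him, hmj'⟩ := hm
      have c1 : (Finset.univ.filter fun x => (f i ≤ f x ∧ g i ≤ g x) ∧ f x ≤ f m ∧ g x ≤ g m).card
          < N := by
        rw [← hN]
        refine Finset.card_lt_card ((Finset.ssubset_iff_of_subset ?_).2 ⟨j, ?_, ?_⟩)
        · intro x
          simp only [Finset.mem_filter, Finset.mem_univ, true_and]
          exact fun h => ⟨h.1, h.2.1.trans hmj'.1, h.2.2.trans hmj'.2⟩
        · simp [hf, hg]
        · simp only [Finset.mem_filter, Finset.mem_univ, true_and, not_and]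
          exact fun _ h1 h2 => hmj (hinj m j (le_antisymm hmj'.1 h1) (le_antisymm hmj'.2 h2))
      have c2 : (Finset.univ.filter fun x => (f m ≤ f x ∧ g m ≤ g x) ∧ f x ≤ f j ∧ g x ≤ g j).card
          < N := by
        rw [← hN]
        refine Finset.card_lt_card ((Finset.ssubset_iff_of_subset ?_).2 ⟨i, ?_, ?_⟩)
        · intro x
          simp only [Finset.mem_filter, Finset.mem_univ, true_and]
          exact fun h => ⟨⟨him.1.trans h.1.1, him.2.trans h.1.2⟩, h.2⟩
        · simp [hf, hg]
        · simp only [Finset.mem_filter, Finset.mem_univ, true_and, not_and]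
          exact fun h _ => absurd (hinj m i (le_antisymm h.1 him.1) (le_antisymm h.2 him.2)) hmi
      obtain ⟨p, hp, hp'⟩ := ih _ c1 i m him.1 him.2 rfl
      obtain ⟨q, hq, hq'⟩ := ih _ c2 m j hmj'.1 hmj'.2 rfl
      refine ⟨p.append q, ?_, ?_⟩
      · rw [SimpleGraph.Walk.support_append, List.pairwise_append]
        refine ⟨hp, hq.sublist (List.tail_sublist _), fun a ha b hb => ?_⟩
        have h1 := (hp' a ha).2
        have h2 := (hq' b (List.mem_of_mem_tail hb)).1
        exact ⟨h1.1.trans h2.1, h1.2.trans h2.2⟩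
      · intro x hx
        rcases (SimpleGraph.Walk.mem_support_append_iff p q).1 hx with hx | hx
        · obtain ⟨h1, h2⟩ := hp' x hx
          exact ⟨h1, h2.1.trans hmj'.1, h2.2.trans hmj'.2⟩
        · obtain ⟨h1, h2⟩ := hq' x hx
          exact ⟨⟨him.1.trans h1.1, him.2.trans h1.2⟩, h2⟩
    · have hadj : (emptyRectGraph f g).Adj i j := by
        refine ⟨hij, fun m hmi hmj ⟨h1, h2⟩ => hm ⟨m, hmi, hmj, ?_⟩⟩
        have between {a b c : ℝ} (hac : a ≤ c) (h : 0 ≤ (b - a) * (c - b)) : a ≤ b ∧ b ≤ c := by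
          constructor <;> by_contra hh <;> push Not at hh <;> nlinarith
        have h3 := between hf h1
        have h4 := between hg h2
        exact ⟨⟨h3.1, h4.1⟩, h3.2, h4.2⟩
      refine ⟨.cons hadj .nil, by simp [hf, hg], ?_⟩
      simp [hf, hg]

/-- In a monotone sequence the second entry lies between the first and any later entry. -/
theorem MonotoneSeq.between {a b c : ℝ} {l : List ℝ} (h : MonotoneSeq (a :: b :: l))
    (hc : c ∈ b :: l) : 0 ≤ (b - a) * (c - b) := by
  rcases h with h | h
  · simp only [List.pairwise_cons] at h
    have h1 := h.1 b (by simp)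
    rcases List.mem_cons.1 hc with rfl | hc
    · simp
    · exact mul_nonneg (by linarith) (by linarith [h.2.1 c hc])
  · simp only [List.pairwise_cons] at h
    have h1 := h.1 b (by simp)
    rcases List.mem_cons.1 hc with rfl | hc
    · simp
    · exact mul_nonneg_of_nonpos_of_nonpos (by linarith) (by linarith [h.2.1 c hc])

/-! ### The least monotone graph for fixed axes -/

section Monotone
variable {n : ℕ} {P : Fin n → Plane} {u v : Plane}

/-- On a monotone path from `i` to `j` the second vertex lies in their rectangle. If that is empty,
this vertex is `j`, and the path begins with the edge itself. -/
theorem XYMonotoneGraph.emptyRectGraph_le {H : SimpleGraph (Fin n)} (h : XYMonotoneGraph P u v H) :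
    emptyRectGraph (fun i => inner ℝ u (P i)) (fun i => inner ℝ v (P i)) ≤ H := by
  rintro i j ⟨hij, hempty⟩
  obtain ⟨w, -, hmono⟩ := h i j
  cases w with
  | nil => exact absurd rfl hij
  | @cons _ m _ hadj p =>
    by_cases hmj : m = j
    · exact hmj ▸ hadj
    refine absurd ⟨?_, ?_⟩ (hempty m hadj.ne' hmj)
    · have h1 := hmono.1
      simp only [SimpleGraph.Walk.support_cons, List.map_cons] at h1
      rw [← p.cons_tail_support, List.map_cons, List.map_cons] at h1
      refine h1.between ?_
      rw [← List.map_cons, ← List.map_cons, p.cons_tail_support]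
      exact List.mem_map_of_mem (List.mem_map_of_mem p.end_mem_support)
    · have h1 := hmono.2
      simp only [SimpleGraph.Walk.support_cons, List.map_cons] at h1
      rw [← p.cons_tail_support, List.map_cons, List.map_cons] at h1
      refine h1.between ?_
      rw [← List.map_cons, ← List.map_cons, p.cons_tail_support]
      exact List.mem_map_of_mem (List.mem_map_of_mem p.end_mem_support)

/-- Signs on the axes put `i` weakly below `j` in both coordinates without changing the graph.
Shortening the walk to a path keeps a sublist of its vertices, hence monotonicity. -/
theorem xyMonotoneGraph_emptyRectGraph
    (hinj : ∀ i j, inner ℝ u (P i) = inner ℝ u (P j) → inner ℝ v (P i) = inner ℝ v (P j) → i = j) :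
    XYMonotoneGraph P u v
      (emptyRectGraph (fun i => inner ℝ u (P i)) (fun i => inner ℝ v (P i))) := by
  classical
  intro i j
  suffices hs : ∃ w : (emptyRectGraph (fun i => inner ℝ u (P i)) (fun i => inner ℝ v (P i))).Walk i j,
      XYMonotoneSeq u v (w.support.map P) by
    obtain ⟨w, h1, h2⟩ := hs
    have hsub := (w.support_bypass_sublist_support).map P
    refine ⟨w.bypass, w.bypass_isPath, ?_, ?_⟩
    · exact h1.imp (fun h => h.sublist (hsub.map _)) (fun h => h.sublist (hsub.map _))
    · exact h2.imp (fun h => h.sublist (hsub.map _)) (fun h => h.sublist (hsub.map _))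
  have sign : ∀ x y : ℝ, ∃ a : ℝ, (a = 1 ∨ a = -1) ∧ a * x ≤ a * y := by
    intro x y
    rcases le_total x y with h | h
    · exact ⟨1, Or.inl rfl, by linarith⟩
    · exact ⟨-1, Or.inr rfl, by linarith⟩
  obtain ⟨a, ha, hf⟩ := sign (inner ℝ u (P i)) (inner ℝ u (P j))
  obtain ⟨b, hb, hg⟩ := sign (inner ℝ v (P i)) (inner ℝ v (P j))
  have ha0 : a ≠ 0 := by rcases ha with rfl | rfl <;> norm_num
  have hb0 : b ≠ 0 := by rcases hb with rfl | rfl <;> norm_num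
  have key := emptyRectGraph_exists_walk (f := fun i => a * inner ℝ u (P i))
    (g := fun i => b * inner ℝ v (P i))
    (fun i j h1 h2 => hinj i j (mul_left_cancel₀ ha0 h1) (mul_left_cancel₀ hb0 h2)) i j hf hg
  rw [emptyRectGraph_smul (fun i => inner ℝ u (P i)) (fun i => inner ℝ v (P i)) ha0 hb0] at key
  obtain ⟨w, hw, -⟩ := key
  have mono (c : ℝ) (hc : c = 1 ∨ c = -1) (f : Plane → ℝ)
      (h : w.support.Pairwise fun x y => c * f (P x) ≤ c * f (P y)) :
      MonotoneSeq ((w.support.map P).map f) := by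
    rcases hc with rfl | rfl
    · left
      rw [List.pairwise_map, List.pairwise_map]
      exact h.imp fun h => by linarith
    · right
      rw [List.pairwise_map, List.pairwise_map]
      exact h.imp fun h => by linarith
  exact ⟨w, mono a ha (fun p => inner ℝ u p) (hw.imp fun h => h.1),
    mono b hb (fun p => inner ℝ v p) (hw.imp fun h => h.2)⟩

end Monotone

namespace RealRAM

/-! ### Slopes -/

/-- Alignment makes one candidate of the maximum equal to `κ`. The other is `-1 / κ`, or 0 by the
division convention when `κ = 0`, and so does not exceed it. -/
theorem dirKey_eq {x y κ : ℝ} (hκ : 0 ≤ κ) (hne : ¬ (x = 0 ∧ y = 0))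
    (h : x + κ * y = 0 ∨ y - κ * x = 0) : dirKey x y = κ := by
  unfold dirKey
  rcases h with h | h
  · have hx : x = -(κ * y) := by linarith
    have hy : y ≠ 0 := fun hy => hne ⟨by simp [hx, hy], hy⟩
    have e : -(x / y) = κ := by rw [hx]; field_simp
    rw [e]
    refine max_eq_right (le_trans ?_ hκ)
    rw [hx]
    rcases hκ.eq_or_lt with h0 | h0
    · simp [← h0]
    · rw [show y / -(κ * y) = -(1 / κ) by field_simp]
      simp [h0.le]
  · have hy : y = κ * x := by linarith
    have hx : x ≠ 0 := fun hx => hne ⟨hx, by simp [hy, hx]⟩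
    have e : y / x = κ := by rw [hy]; field_simp
    rw [e]
    refine max_eq_left (le_trans ?_ hκ)
    rw [hy]
    rcases hκ.eq_or_lt with h0 | h0
    · simp [← h0]
    · rw [show x / (κ * x) = 1 / κ by field_simp]
      simp [h0.le]

theorem dirKey_aligned (x y : ℝ) : x + dirKey x y * y = 0 ∨ y - dirKey x y * x = 0 := by
  by_cases hx : x = 0
  · left; simp [dirKey, hx]
  by_cases hy : y = 0
  · right; simp [dirKey, hy]
  rcases max_choice (y / x) (-(x / y)) with h | h
  · right
    rw [dirKey, h]; field_simp; simp
  · left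
    rw [dirKey, h]; field_simp; simp

theorem exists_zero_of_neg {h : ℝ → ℝ} (hc : Continuous h) {s t : ℝ} (hs : ¬ h s < 0)
    (ht : h t < 0) : ∃ x ∈ Set.uIcc s t, x ≠ t ∧ h x = 0 := by
  obtain ⟨x, hx, hx0⟩ := intermediate_value_uIcc (a := s) (b := t) hc.continuousOn
    (Set.mem_uIcc.2 (Or.inr ⟨ht.le, not_lt.1 hs⟩) : (0 : ℝ) ∈ Set.uIcc (h s) (h t))
  exact ⟨x, hx, by rintro rfl; exact ht.ne hx0, hx0⟩

/-- Blocking demands that two products, continuous in the slope, be nonnegative. If it fails at `t`,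
one of them is strictly negative there, so by the intermediate value theorem a factor vanishes on
the way, and not at `t` itself. -/
theorem Blocks.exists_aligned {px py : ℕ → ℝ} {s t : ℝ} {i j m : ℕ} (hs : Blocks px py s i j m)
    (ht : ¬ Blocks px py t i j m) : ∃ x ∈ Set.uIcc s t, x ≠ t ∧
      (((px m - px i) + x * (py m - py i) = 0 ∨ (py m - py i) - x * (px m - px i) = 0) ∨
      ((px j - px m) + x * (py j - py m) = 0 ∨ (py j - py m) - x * (px j - px m) = 0)) := by
  obtain ⟨h1, h2, h3, h4, h5⟩ := hs
  have : (px m - px i + t * (py m - py i)) * (px j - px m + t * (py j - py m)) < 0 ∨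
      (py m - py i - t * (px m - px i)) * (py j - py m - t * (px j - px m)) < 0 := by
    by_contra hh
    push Not at hh
    exact ht ⟨h1, h2, h3, not_lt.2 hh.1, not_lt.2 hh.2⟩
  rcases this with h | h
  · obtain ⟨x, hx, hxt, h0⟩ := exists_zero_of_neg (h := fun x =>
      (px m - px i + x * (py m - py i)) * (px j - px m + x * (py j - py m)))
      (by fun_prop) h4 h
    rcases mul_eq_zero.1 h0 with h0 | h0
    exacts [⟨x, hx, hxt, Or.inl (Or.inl h0)⟩, ⟨x, hx, hxt, Or.inr (Or.inl h0)⟩]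
  · obtain ⟨x, hx, hxt, h0⟩ := exists_zero_of_neg (h := fun x =>
      (py m - py i - x * (px m - px i)) * (py j - py m - x * (px j - px m)))
      (by fun_prop) h5 h
    rcases mul_eq_zero.1 h0 with h0 | h0
    exacts [⟨x, hx, hxt, Or.inl (Or.inr h0)⟩, ⟨x, hx, hxt, Or.inr (Or.inr h0)⟩]

theorem pairKey_comm (px py : ℕ → ℝ) (i j : ℕ) : pairKey px py i j = pairKey px py j i := by
  rw [pairKey, pairKey, ← dirKey_neg]
  congr 1 <;> ring

/-- The points are distinct. -/
def DistinctPoints (n : ℕ) (px py : ℕ → ℝ) : Prop :=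
  ∀ i < n, ∀ j < n, px i = px j → py i = py j → i = j

theorem Blocks.exists_pairKey {n : ℕ} {px py : ℕ → ℝ} (hd : DistinctPoints n px py) {s t : ℝ}
    (hs0 : 0 ≤ s) (ht0 : 0 ≤ t) {i j m : ℕ} (hi : i < n) (hj : j < n) (hm : m < n)
    (hs : Blocks px py s i j m) (ht : ¬ Blocks px py t i j m) :
    ∃ p q, p < q ∧ q < n ∧ pairKey px py p q ∈ Set.uIcc s t ∧ pairKey px py p q ≠ t ∧
      Touches p q i j m := by
  obtain ⟨x, hx, hxt, h⟩ := hs.exists_aligned ht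
  have hx0 : 0 ≤ x := (le_inf hs0 ht0).trans hx.1
  have hmi := hs.2.1
  have hmj := hs.2.2.1
  rcases h with h | h
  · have hk : pairKey px py i m = x := dirKey_eq hx0
      (fun hh => hmi (hd m hm i hi (by linarith [hh.1]) (by linarith [hh.2]))) h
    rcases lt_or_gt_of_ne hmi with hlt | hlt
    · exact ⟨m, i, hlt, hi, by rwa [pairKey_comm, hk], by rwa [pairKey_comm, hk], by simp [Touches]⟩
    · exact ⟨i, m, hlt, hm, by rwa [hk], by rwa [hk], by simp [Touches]⟩
  · have hk : pairKey px py m j = x := dirKey_eq hx0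
      (fun hh => hmj (hd m hm j hj (by linarith [hh.1]) (by linarith [hh.2]))) h
    rcases lt_or_gt_of_ne hmj with hlt | hlt
    · exact ⟨m, j, hlt, hj, by rwa [hk], by rwa [hk], by simp [Touches]⟩
    · exact ⟨j, m, hlt, hm, by rwa [pairKey_comm, hk], by rwa [pairKey_comm, hk], by simp [Touches]⟩

/-- Take for `κ'` the largest element not above `κ` among 0 and the keys. A blocked triple lost on
the way down would produce a key above `κ'` and at most `κ`, against maximality. -/
theorem exists_critical_slope {n : ℕ} {px py : ℕ → ℝ} (hd : DistinctPoints n px py) {κ : ℝ}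
    (hκ : 0 ≤ κ) : ∃ κ', (κ' = 0 ∨ ∃ i j, i < j ∧ j < n ∧ κ' = pairKey px py i j) ∧
      ∀ i < n, ∀ j < n, ∀ m < n, Blocks px py κ i j m → Blocks px py κ' i j m := by
  classical
  set A : Finset ℝ := insert 0 (((Finset.range n ×ˢ Finset.range n).filter fun p => p.1 < p.2).image
    fun p => pairKey px py p.1 p.2) with hA
  have h0 : (A.filter (· ≤ κ)).Nonempty := ⟨0, by simp [hA, hκ]⟩
  obtain ⟨κ', hκ', hmax⟩ := Finset.exists_max_image _ id h0
  simp only [Finset.mem_filter] at hκ'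
  have hcase : κ' = 0 ∨ ∃ i j, i < j ∧ j < n ∧ κ' = pairKey px py i j := by
    rcases Finset.mem_insert.1 hκ'.1 with h | h
    · exact Or.inl h
    · simp only [Finset.mem_image, Finset.mem_filter, Finset.mem_product, Finset.mem_range] at h
      obtain ⟨⟨i, j⟩, ⟨⟨-, hj⟩, hij⟩, h⟩ := h
      exact Or.inr ⟨i, j, hij, hj, h.symm⟩
  have hκ'0 : 0 ≤ κ' := by
    rcases hcase with rfl | ⟨i, j, -, -, rfl⟩
    exacts [le_rfl, dirKey_nonneg _ _]
  refine ⟨κ', hcase, fun i hi j hj m hm hb => ?_⟩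
  by_contra hb'
  obtain ⟨p, q, hpq, hq, hmem, hne, -⟩ := hb.exists_pairKey hd hκ hκ'0 hi hj hm hb'
  rw [Set.uIcc_of_ge hκ'.2, Set.mem_Icc] at hmem
  refine hne (le_antisymm (hmax _ ?_) hmem.1)
  simp only [hA, Finset.mem_filter, Finset.mem_insert, Finset.mem_image, Finset.mem_product,
    Finset.mem_range]
  exact ⟨Or.inr ⟨(p, q), ⟨⟨hpq.trans hq, hq⟩, hpq⟩, rfl⟩, hmem.2⟩

end RealRAM

namespace RealRAM
open Finset

/-! ### The graph of a slope -/

/-- The graph that the program writes for the slope `κ`. -/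
def slopeGraph (n : ℕ) (px py : ℕ → ℝ) (κ : ℝ) : SimpleGraph (Fin n) :=
  emptyRectGraph (fun i => px i + κ * py i) (fun i => py i - κ * px i)

theorem slopeGraph_adj {n : ℕ} {px py : ℕ → ℝ} {κ : ℝ} {i j : Fin n} :
    (slopeGraph n px py κ).Adj i j ↔ (i : ℕ) ≠ j ∧ ∀ m < n, ¬ Blocks px py κ i j m := by
  have e1 (a b : ℕ) : px a + κ * py a - (px b + κ * py b) = px a - px b + κ * (py a - py b) := by
    ring
  have e2 (a b : ℕ) : py a - κ * px a - (py b - κ * px b) = py a - py b - κ * (px a - px b) := by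
    ring
  simp only [slopeGraph, emptyRectGraph, Blocks, e1, e2, not_lt, ne_eq, Fin.ext_iff]
  constructor
  · rintro ⟨h, h'⟩
    exact ⟨h, fun m hm ⟨_, h1, h2, h3, h4⟩ => h' ⟨m, hm⟩ h1 h2 ⟨h3, h4⟩⟩
  · rintro ⟨h, h'⟩
    exact ⟨h, fun m h1 h2 ⟨h3, h4⟩ => h' m m.2 ⟨h, h1, h2, h3, h4⟩⟩

/-! ### From point sets to slopes, and optimality -/

section Points
variable {n : ℕ} (P : Fin n → Plane)

/-- First coordinates of the points, extended by zero. -/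
noncomputable def fstCoord : ℕ → ℝ := (inputState P).rarr 0

/-- Second coordinates of the points, extended by zero. -/
noncomputable def sndCoord : ℕ → ℝ := (inputState P).rarr 1

@[simp] theorem fstCoord_fin (i : Fin n) : fstCoord P i = P i 0 := by
  simp [fstCoord, inputState]

@[simp] theorem sndCoord_fin (i : Fin n) : sndCoord P i = P i 1 := by
  simp [sndCoord, inputState]

theorem isInitial_inputState : IsInitial n (fstCoord P) (sndCoord P) (inputState P) where
  input := ⟨rfl, rfl, rfl⟩
  nvar x hx := by simp [inputState, hx]
  rvar _ := rfl
  narr _ _ := rfl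

theorem inner_eq_coord (u p : Plane) : inner ℝ u p = u 0 * p 0 + u 1 * p 1 := by
  simp [PiLp.inner_apply, Fin.sum_univ_two, mul_comm]

variable {P}

theorem distinctPoints (hP : Function.Injective P) :
    DistinctPoints n (fstCoord P) (sndCoord P) := by
  intro i hi j hj h1 h2
  have e1 := fstCoord_fin P ⟨i, hi⟩
  have e2 := fstCoord_fin P ⟨j, hj⟩
  have e3 := sndCoord_fin P ⟨i, hi⟩
  have e4 := sndCoord_fin P ⟨j, hj⟩
  simp only at e1 e2 e3 e4
  have : P ⟨i, hi⟩ = P ⟨j, hj⟩ := by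
    ext k
    fin_cases k
    · simp only [Fin.zero_eta]
      rw [← e1, ← e2, h1]
    · simp only [Fin.mk_one]
      rw [← e3, ← e4, h2]
  simpa using hP this

theorem sweepFacts (hP : GeneralPosition P) : SweepFacts n (fstCoord P) (sndCoord P) where
  key_inj i j i' j' hij hj hij' hj' heq := by
    by_contra hne
    have hs : s((⟨i, hij.trans hj⟩ : Fin n), ⟨j, hj⟩) ≠ s(⟨i', hij'.trans hj'⟩, ⟨j', hj'⟩) := by
      intro hs
      simp only [Sym2.eq_iff, Fin.mk.injEq] at hs
      omega
    have hi1 : (⟨i, hij.trans hj⟩ : Fin n) ≠ ⟨j, hj⟩ := by simp; omega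
    have hi2 : (⟨i', hij'.trans hj'⟩ : Fin n) ≠ ⟨j', hj'⟩ := by simp; omega
    have hpar := hP.not_parallel _ _ _ _ hi1 hi2 hs
    have hort := hP.not_orthogonal _ _ _ _ hi1 hi2 hs
    rw [inner_eq_coord] at hort
    simp only [PiLp.sub_apply, ← fstCoord_fin, ← sndCoord_fin] at hpar hort
    have h1 := dirKey_aligned (fstCoord P j - fstCoord P i) (sndCoord P j - sndCoord P i)
    have h2 := dirKey_aligned (fstCoord P j' - fstCoord P i') (sndCoord P j' - sndCoord P i')
    simp only [pairKey] at heq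
    rw [← heq] at h2
    generalize dirKey (fstCoord P j - fstCoord P i) (sndCoord P j - sndCoord P i) = κ at h1 h2
    generalize fstCoord P j - fstCoord P i = x at *
    generalize fstCoord P j' - fstCoord P i' = x' at *
    generalize sndCoord P j - sndCoord P i = y at *
    generalize sndCoord P j' - sndCoord P i' = y' at *
    -- Both vectors are parallel to axes of the same slope: the same axis makes the cross product
    -- vanish, different axes the inner product.
    rcases h1 with h1 | h1 <;> rcases h2 with h2 | h2
    · exact hpar (by linear_combination y' * h1 - y * h2)
    · exact hort (by linear_combination x' * h1 + y * h2)
    · exact hort (by linear_combination y' * h1 + x * h2)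
    · exact hpar (by linear_combination x * h2 - x' * h1)
  change κ κ' i j m hi hj hm hκ hle := by
    have hd := distinctPoints hP.injective
    by_cases h : Blocks (fstCoord P) (sndCoord P) κ i j m ↔ Blocks (fstCoord P) (sndCoord P) κ' i j m
    · exact Or.inl h
    right
    by_cases hb : Blocks (fstCoord P) (sndCoord P) κ i j m
    · obtain ⟨p, q, hpq, hq, hmem, -, hT⟩ := hb.exists_pairKey hd hκ (hκ.trans hle) hi hj hm
        (fun hb' => h ⟨fun _ => hb', fun _ => hb⟩)
      rw [Set.uIcc_of_le hle] at hmem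
      exact ⟨p, q, hpq, hq, hmem.1, hmem.2, hT⟩
    · have hb' : Blocks (fstCoord P) (sndCoord P) κ' i j m := by tauto
      obtain ⟨p, q, hpq, hq, hmem, -, hT⟩ := hb'.exists_pairKey hd (hκ.trans hle) hκ hi hj hm hb
      rw [Set.uIcc_of_ge hle] at hmem
      exact ⟨p, q, hpq, hq, hmem.1, hmem.2, hT⟩

/-- Up to scaling, reflection and exchange, orthogonal axes are given by a slope `κ ≥ 0`. -/
theorem OrthogonalAxes.exists_slope {u v : Plane} (h : OrthogonalAxes u v) (P : Fin n → Plane) :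
    ∃ κ : ℝ, 0 ≤ κ ∧ emptyRectGraph (fun i => inner ℝ u (P i)) (fun i => inner ℝ v (P i)) =
      slopeGraph n (fstCoord P) (sndCoord P) κ := by
  obtain ⟨hu, hv, huv⟩ := h
  have norm_sq (x : Plane) (hx : ‖x‖ = 1) : x 0 ^ 2 + x 1 ^ 2 = 1 := by
    have := EuclideanSpace.norm_sq_eq x
    rw [hx, Fin.sum_univ_two] at this
    simpa using this.symm
  have hu2 := norm_sq u hu
  have hv2 := norm_sq v hv
  rw [inner_eq_coord] at huv
  simp only [inner_eq_coord, slopeGraph, fstCoord_fin, sndCoord_fin]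
  obtain ⟨a, ha⟩ : ∃ a, u 0 = a := ⟨_, rfl⟩
  obtain ⟨b, hb⟩ : ∃ b, u 1 = b := ⟨_, rfl⟩
  obtain ⟨c, hc⟩ : ∃ c, v 0 = c := ⟨_, rfl⟩
  obtain ⟨d, hd⟩ : ∃ d, v 1 = d := ⟨_, rfl⟩
  simp only [ha, hb, hc, hd] at hu2 hv2 huv ⊢
  -- `ε` is the determinant of the two axes; orthonormality forces `v = ε * (-b, a)`.
  obtain ⟨ε, hε, hc', hd'⟩ : ∃ ε : ℝ, ε ≠ 0 ∧ c = -ε * b ∧ d = ε * a := by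
    refine ⟨a * d - b * c, fun h0 => ?_, ?_, ?_⟩
    · have : (a * d - b * c) ^ 2 + (a * c + b * d) ^ 2 = 1 := by
        calc _ = (a ^ 2 + b ^ 2) * (c ^ 2 + d ^ 2) := by ring
          _ = 1 := by rw [hu2, hv2]; norm_num
      rw [h0, huv] at this
      norm_num at this
    · linear_combination (-c) * hu2 + a * huv
    · linear_combination (-d) * hu2 + b * huv
  subst hc' hd'
  -- If `b / a` is not available as a nonnegative slope, the axes are exchanged and `-(a / b)` is
  -- used.
  by_cases hab : 0 ≤ a * b ∧ a ≠ 0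
  · have ha0 := hab.2
    refine ⟨b / a, ?_, ?_⟩
    · rw [show b / a = a * b / (a * a) by field_simp]
      exact div_nonneg hab.1 (mul_self_nonneg a)
    · rw [← emptyRectGraph_smul (fun i => P i 0 + b / a * P i 1) (fun i => P i 1 - b / a * P i 0)
        ha0 (mul_ne_zero hε ha0)]
      congr 1 <;> funext i <;> field_simp
      ring
  · have hb0 : b ≠ 0 := by
      rintro rfl
      have : a = 0 := by
        by_contra hh
        exact hab ⟨by simp, hh⟩
      simp [this] at hu2
    refine ⟨-(a / b), ?_, ?_⟩
    · rw [show -(a / b) = -(a * b) / (b * b) by field_simp]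
      refine div_nonneg ?_ (mul_self_nonneg b)
      by_cases ha0 : a = 0
      · simp [ha0]
      · have : ¬ 0 ≤ a * b := fun hh => hab ⟨hh, ha0⟩
        linarith
    · rw [emptyRectGraph_swap, ← emptyRectGraph_smul (fun i => P i 0 + -(a / b) * P i 1)
        (fun i => P i 1 - -(a / b) * P i 0) (mul_ne_zero (neg_ne_zero.2 hε) hb0) hb0]
      congr 1 <;> funext i <;> field_simp <;> ring

/-- Dividing `(1, κ)` and `(-κ, 1)` by their common length gives orthogonal axes. Their determinant
before scaling is `1 + κ ^ 2`, so the two coordinates together separate the points. -/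
theorem uniformMonotone2D_slopeGraph (hP : Function.Injective P) (κ : ℝ) :
    UniformMonotone2D P (slopeGraph n (fstCoord P) (sndCoord P) κ) := by
  have hpos : 0 < 1 + κ ^ 2 := by positivity
  obtain ⟨r, hr, hr2⟩ : ∃ r : ℝ, r ≠ 0 ∧ r ^ 2 * (1 + κ ^ 2) = 1 := by
    refine ⟨(Real.sqrt (1 + κ ^ 2))⁻¹, inv_ne_zero (Real.sqrt_pos.2 hpos).ne', ?_⟩
    rw [inv_pow, Real.sq_sqrt hpos.le, inv_mul_cancel₀ hpos.ne']
  set u : Plane := !₂[r, r * κ] with hu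
  set v : Plane := !₂[-(r * κ), r] with hv
  have u0 : u 0 = r := by simp [hu]
  have u1 : u 1 = r * κ := by simp [hu]
  have v0 : v 0 = -(r * κ) := by simp [hv]
  have v1 : v 1 = r := by simp [hv]
  have norm_one (x : Plane) (hx : x 0 ^ 2 + x 1 ^ 2 = 1) : ‖x‖ = 1 := by
    rw [EuclideanSpace.norm_eq, Fin.sum_univ_two]
    simp [hx]
  refine ⟨u, v, ⟨norm_one u ?_, norm_one v ?_, ?_⟩, ?_⟩
  · rw [u0, u1]; linear_combination hr2
  · rw [v0, v1]; linear_combination hr2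
  · rw [inner_eq_coord, u0, u1, v0, v1]; ring
  have hX (p : Plane) : inner ℝ u p = r * (p 0 + κ * p 1) := by
    rw [inner_eq_coord, u0, u1]; ring
  have hY (p : Plane) : inner ℝ v p = r * (p 1 - κ * p 0) := by
    rw [inner_eq_coord, v0, v1]; ring
  have key := xyMonotoneGraph_emptyRectGraph (P := P) (u := u) (v := v) ?_
  · simp only [hX, hY] at key
    rw [emptyRectGraph_smul _ _ hr hr] at key
    simpa only [slopeGraph, fstCoord_fin, sndCoord_fin] using key
  · intro i j h1 h2
    rw [hX, hX] at h1
    rw [hY, hY] at h2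
    have h1 := mul_left_cancel₀ hr h1
    have h2 := mul_left_cancel₀ hr h2
    have e1 : P i 1 = P j 1 := by
      have : (1 + κ ^ 2) * P i 1 = (1 + κ ^ 2) * P j 1 := by linear_combination κ * h1 + h2
      exact mul_left_cancel₀ hpos.ne' this
    have e0 : P i 0 = P j 0 := by rw [e1] at h1; linarith
    refine hP ?_
    ext k
    fin_cases k
    exacts [e0, e1]

/-! ### Weights -/

open Classical in
/-- The total weight of the ordered pairs of adjacent vertices. -/
noncomputable def graphWeight (w : ℕ → ℕ → ℝ) (G : SimpleGraph (Fin n)) : ℝ :=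
  ∑ i : Fin n, ∑ j : Fin n, if G.Adj i j then w i j else 0

theorem graphWeight_mono {w : ℕ → ℕ → ℝ} (hw : ∀ i j, 0 ≤ w i j) {G H : SimpleGraph (Fin n)}
    (h : G ≤ H) : graphWeight w G ≤ graphWeight w H := by
  refine Finset.sum_le_sum fun i _ => Finset.sum_le_sum fun j _ => ?_
  split_ifs with h1 h2
  exacts [le_rfl, absurd (h h1) h2, hw _ _, le_rfl]

/-- Every ordered pair of distinct indices is either adjacent or blocked. `Blocks` requires `i ≠ j`,
so the diagonal contributes nothing. -/
theorem graphWeight_add_blockedWeight (px py : ℕ → ℝ) (w : ℕ → ℕ → ℝ) (κ : ℝ) :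
    graphWeight w (slopeGraph n px py κ) + blockedWeight n w (Blocks px py κ) =
      ∑ i : Fin n, ∑ j : Fin n, if i ≠ j then w i j else 0 := by
  classical
  rw [blockedWeight, Finset.sum_product, Finset.sum_range]
  simp only [Finset.sum_range, graphWeight]
  rw [← Finset.sum_add_distrib]
  refine Finset.sum_congr rfl fun i _ => ?_
  rw [← Finset.sum_add_distrib]
  refine Finset.sum_congr rfl fun j _ => ?_
  rw [show (if (slopeGraph n px py κ).Adj i j then w i j else 0)
    = if (i : ℕ) ≠ j ∧ ∀ m < n, ¬ Blocks px py κ i j m then w i j else 0 by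
      by_cases h : (slopeGraph n px py κ).Adj i j
      · rw [if_pos h, if_pos (slopeGraph_adj.1 h)]
      · rw [if_neg h, if_neg (mt slopeGraph_adj.2 h)]]
  by_cases hb : ∃ m < n, Blocks px py κ i j m
  · obtain ⟨m, hm, hbm⟩ := hb
    rw [if_neg (fun hh => hh.2 m hm hbm), if_pos ⟨m, hm, hbm⟩,
      if_pos (fun hh => hbm.1 (congrArg Fin.val hh)), zero_add]
  · rw [if_neg hb, add_zero]
    by_cases hij : i = j
    · rw [if_neg (fun hh => hh.1 (congrArg Fin.val hij)), if_neg (not_not.2 hij)]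
    · rw [if_pos ⟨fun hh => hij (Fin.ext hh), fun m hm hbm => hb ⟨m, hm, hbm⟩⟩, if_pos hij]

/-- A competitor contains the graph of its own slope `κ₁`, which contains that of a critical slope
`κ₂`, which weighs at least as much as that of `κ`. -/
theorem IsOptimalSlope.graphWeight_le {w : ℕ → ℕ → ℝ} (hw : ∀ i j, 0 ≤ w i j)
    (hP : Function.Injective P) {κ : ℝ} (hκ : IsOptimalSlope n (fstCoord P) (sndCoord P) w κ)
    {H : SimpleGraph (Fin n)} (hH : UniformMonotone2D P H) :
    graphWeight w (slopeGraph n (fstCoord P) (sndCoord P) κ) ≤ graphWeight w H := by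
  obtain ⟨u, v, huv, hmono⟩ := hH
  obtain ⟨κ₁, hκ₁, heq⟩ := OrthogonalAxes.exists_slope huv P
  have hle := hmono.emptyRectGraph_le
  rw [heq] at hle
  obtain ⟨κ₂, hκ₂, hb⟩ := exists_critical_slope (distinctPoints hP) hκ₁
  have hle₂ : slopeGraph n (fstCoord P) (sndCoord P) κ₂ ≤
      slopeGraph n (fstCoord P) (sndCoord P) κ₁ := by
    intro i j hij
    rw [slopeGraph_adj] at hij ⊢
    exact ⟨hij.1, fun m hm hbm => hij.2 m hm (hb i i.2 j j.2 m hm hbm)⟩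
  have h1 := graphWeight_add_blockedWeight (n := n) (fstCoord P) (sndCoord P) w κ
  have h2 := graphWeight_add_blockedWeight (n := n) (fstCoord P) (sndCoord P) w κ₂
  have h3 : blockedWeight n w (Blocks (fstCoord P) (sndCoord P) κ₂) ≤
      blockedWeight n w (Blocks (fstCoord P) (sndCoord P) κ) := by
    rcases hκ₂ with rfl | ⟨i, j, hij, hj, rfl⟩
    exacts [hκ.2.1, hκ.2.2 i j hij hj]
  have h4 := graphWeight_mono hw hle₂
  have h5 := graphWeight_mono hw hle
  linarith

open Classical in
theorem two_mul_graphCost (w : ℕ → ℕ → ℝ) (hw : ∀ i j : Fin n, w i j = dist (P i) (P j))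
    (G : SimpleGraph (Fin n)) : 2 * graphCost P G = graphWeight w G := by
  have h1 : graphWeight w G = graphCost P G +
      ∑ i : Fin n, ∑ j : Fin n, if j < i ∧ G.Adj i j then dist (P i) (P j) else 0 := by
    simp only [graphWeight, graphCost, ← Finset.sum_add_distrib]
    refine Finset.sum_congr rfl fun i _ => Finset.sum_congr rfl fun j _ => ?_
    rw [hw]
    by_cases h : G.Adj i j
    · rcases lt_or_gt_of_ne h.ne with hlt | hlt
      · simp [h, hlt, hlt.not_gt]
      · simp [h, hlt, hlt.not_gt]
    · simp [h]
  have h2 : (∑ i : Fin n, ∑ j : Fin n, if j < i ∧ G.Adj i j then dist (P i) (P j) else 0)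
      = graphCost P G := by
    rw [Finset.sum_comm, graphCost]
    refine Finset.sum_congr rfl fun i _ => Finset.sum_congr rfl fun j _ => ?_
    simp only [G.adj_comm j i, dist_comm (P j) (P i)]
  rw [h1, h2]
  ring

theorem two_mul_ncard_edgeSet (G : SimpleGraph (Fin n)) :
    (2 * G.edgeSet.ncard : ℝ) = graphWeight (fun _ _ => 1) G := by
  classical
  have h := G.sum_degrees_eq_twice_card_edges
  have h1 : G.edgeSet.ncard = G.edgeFinset.card := by
    rw [← SimpleGraph.coe_edgeFinset, Set.ncard_coe_finset]
  rw [h1]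
  have h2 : ((∑ v, G.degree v : ℕ) : ℝ) = 2 * (G.edgeFinset.card : ℝ) := by
    rw [h]; push_cast; rfl
  rw [← h2, graphWeight]
  push_cast
  refine Finset.sum_congr rfl fun i _ => ?_
  rw [← SimpleGraph.card_neighborFinset_eq_degree, SimpleGraph.neighborFinset_eq_filter,
    Finset.card_filter]
  push_cast
  rfl

end Points

/-! ### Solving the two problems -/

/-- The two problems differ only in the weight of an edge. Any nonnegative weight computable by an
expression in the coordinates can be treated by the same sweep. -/
theorem solvableInTime_of_weight (wE : ℕ → ℕ → RExpr) (w : (ℕ → ℝ) → (ℕ → ℝ) → ℕ → ℕ → ℝ)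
    (hw0 : ∀ px py i j, 0 ≤ w px py i j)
    (hw : ∀ W px py, 1 ≤ W → ComputesWeight W px py (w px py) wE)
    (Sol : ∀ {n : ℕ}, (Fin n → Plane) → SimpleGraph (Fin n) → Prop)
    (hSol : ∀ {n : ℕ} (P : Fin n → Plane) (G : SimpleGraph (Fin n)), UniformMonotone2D P G →
      (∀ H : SimpleGraph (Fin n), UniformMonotone2D P H →
        graphWeight (w (fstCoord P) (sndCoord P)) G ≤ graphWeight (w (fstCoord P) (sndCoord P)) H) →
      Sol P G) :
    SolvableInTime (fun n => n ^ 3) Sol := by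
  classical
  obtain ⟨K, hK⟩ := sweepTime_le wE
  -- The exponent 3 makes room for indices of triples; `K + 1` instead of `K` ensures a positive
  -- constant in the word bound.
  refine ⟨sweep wE, K + 1, 3, fun n P hP => ?_⟩
  have hone : 1 ≤ (n + 1) ^ 3 := Nat.one_le_pow _ _ (Nat.succ_pos n)
  have hW : (n + 1) ^ 3 ≤ (K + 1) * (n + 1) ^ 3 := Nat.le_mul_of_pos_left _ (Nat.succ_pos K)
  obtain ⟨t, s, he, ht, κ, hκ, hout⟩ := sweep_runs (hw _ (fstCoord P) (sndCoord P) (hone.trans hW))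
    hW (sweepFacts hP) (isInitial_inputState P)
  refine ⟨t, s, slopeGraph n (fstCoord P) (sndCoord P) κ, he, ?_, ?_, ?_⟩
  · exact ht.trans ((hK n).trans (Nat.mul_le_mul_right _ (Nat.le_succ K)))
  · intro i j
    rw [hout i i.2 j j.2]
    by_cases h : (slopeGraph n (fstCoord P) (sndCoord P) κ).Adj i j
    · rw [if_pos h, if_pos (slopeGraph_adj.1 h)]
    · rw [if_neg h, if_neg (mt slopeGraph_adj.2 h)]
  · exact hSol P _ (uniformMonotone2D_slopeGraph hP.injective κ)
      fun H hH => hκ.graphWeight_le (hw0 _ _) hP.injective hH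

/-- The Euclidean distance of the points in two word variables. -/
def distE (x y : ℕ) : RExpr :=
  .sqrt (.add (.mul (diffE 0 x y) (diffE 0 x y)) (.mul (diffE 1 x y) (diffE 1 x y)))

theorem solvableInTime_minCost :
    SolvableInTime (fun n => n ^ 3) (fun P G => IsMinCostUniform P G) := by
  refine solvableInTime_of_weight distE
    (fun px py i j => Real.sqrt ((px j - px i) * (px j - px i) + (py j - py i) * (py j - py i)))
    (fun _ _ _ _ => Real.sqrt_nonneg _) (fun W px py _ => ⟨?_, ?_⟩) _ ?_
  · intro s x y hx hy
    simp [distE, diffE, RExpr.eval, NExpr.eval, hx, hy]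
  · intro s x y hx hy
    simp [distE, diffE, RExpr.Fits, NExpr.Fits, hx, hy]
  · refine fun {n} P G hG hmin => ⟨hG, fun H hH => ?_⟩
    have hdist (i j : Fin n) : Real.sqrt ((fstCoord P j - fstCoord P i) *
        (fstCoord P j - fstCoord P i) + (sndCoord P j - sndCoord P i) *
        (sndCoord P j - sndCoord P i)) = dist (P i) (P j) := by
      rw [dist_comm, EuclideanSpace.dist_eq, Fin.sum_univ_two]
      simp only [fstCoord_fin, sndCoord_fin, Real.dist_eq, sq]
      simp
    have h := hmin H hH
    rw [← two_mul_graphCost _ hdist, ← two_mul_graphCost _ hdist] at h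
    linarith

theorem solvableInTime_minEdges :
    SolvableInTime (fun n => n ^ 3) (fun P G => IsMinEdgesUniform P G) := by
  refine solvableInTime_of_weight (fun _ _ => .ofNat (.const 1)) (fun _ _ _ _ => 1)
    (fun _ _ _ _ => zero_le_one) (fun W px py hW => ⟨?_, ?_⟩) _ ?_
  · intro s x y _ _
    simp [RExpr.eval, NExpr.eval]
  · intro s x y _ _
    exact hW
  · refine fun {n} P G hG hmin => ⟨hG, fun H hH => ?_⟩
    have h := hmin H hH
    rw [← two_mul_ncard_edgeSet, ← two_mul_ncard_edgeSet] at h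
    exact_mod_cast (by linarith : (G.edgeSet.ncard : ℝ) ≤ H.edgeSet.ncard)

end RealRAM

/-- Both a minimum-cost uniform 2D-monotone spanning graph and one with the least number of edges
of a point set `P` in general position can be computed in `O(|P| ^ 3)` time on a real RAM. -/
theorem theorem1 :
    RealRAM.SolvableInTime (fun n => n ^ 3) (fun P G => IsMinCostUniform P G) ∧
      RealRAM.SolvableInTime (fun n => n ^ 3) (fun P G => IsMinEdgesUniform P G) :=
  ⟨RealRAM.solvableInTime_minCost, RealRAM.solvableInTime_minEdges⟩
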